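/- Definitions. A $C^\infty$-ring is a product preserving functor from the category of the spaces $\mathbb R^n$ ($n\ge 0$) and smooth maps to sets; equivalently, a set $A$ on which every smooth function $\mathbb R^n\to\mathbb R$ acts as an $n$-ary operation, compatibly with projections and composition. Each $C^\infty$-ring has an underlying commutative ring. It is finitely generated if it is a quotient of some $C^\infty(\mathbb R^n)$. An ideal $I\subseteq C^\infty(\mathbb R^n)$ is germ determined if for each $f\in C^\infty(\mathbb R^n)\setminus I$ there is $p\in\mathbb R^n$ such that the germ $f_p$ is not in $I_p=\{g_p: g\in I\}$; a $C^\infty$-ring is germ determined if it is isomorphic to $C^\infty(\mathbb R^n)/I$ for some $n$ and some germ determined ideal $I$. Let $\mathcal G$ be the category of finitely generated germ determined $C^\infty$-rings (a full subcategory of the category of $C^\infty$-rings). A $C^\infty$-space is a pair $(X,\mathcal O_X)$, where $X$ is a Hausdorff topological space and $\mathcal O_X$ is a sheaf of $C^\infty$-rings on $X$, such that $\mathcal O_X(U)$ is finitely generated for every open $U\subseteq X$, $\mathcal O_X$ is soft (every section over a closed subset extends to a global section), and every stalk is a local ring with residue field isomorphic to $\mathbb R$. A morphism $(X,\mathcal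 O_X)\to(Y,\mathcal O_Y)$ is a pair $(\phi,\phi^\sharp)$ of a continuous map $\phi:X\to Y$ and a morphism $\phi^\sharp:\mathcal O_Y\to\phi_*\mathcal O_X$ of sheaves of $C^\infty$-rings. Let $\mathbb G$ be the category of $C^\infty$-spaces, and let $\Gamma$ be the functor of global sections $(X,\mathcal O_X)\mapsto\mathcal O_X(X)$. For a $C^\infty$-ring $A$, let $Sp(A)$ be the set of morphisms of $C^\infty$-rings $A\to\mathbb R$, with the topology generated by the sets $U_a=\{p: p(a)\neq 0\}$, $a\in A$, and let $\mathcal O_{Sp(A)}$ be the sheaf of $C^\infty$-rings associated to $U_a\mapsto A\{a^{-1}\}$, where $A\{a^{-1}\}$ is obtained from $A$ by universally inverting, in the category of $C^\infty$-rings, all $a'\in A$ that vanish nowhere on $U_a$ (that is, $p(a')\neq0$ for all $p\in U_a$). Let $\mathbf{Sp}$ be the contravariant functor $A\mapsto (Sp(A),\mathcal O_{Sp(A)})$. Proposition. For every $C^\infty$-space $(X,\mathcal O_X)$, the $C^\infty$-ring $\Gamma(X,\mathcal O_X)$ is finitely generated and germ determined, i.e. it is in $\mathcal G$. For every $A\in\mathcal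 G$, $\mathbf{Sp}(A)$ is a $C^\infty$-space. Moreover, the functors $$\mathbf{Sp}:\mathcal G^{op}\rightleftarrows\mathbb G:\Gamma$$ are mutually inverse equivalences of categories. -/

import Mathlib

open CategoryTheory TopologicalSpace Opposite
open scoped ContDiff Topology

universe u v w

noncomputable section

/-! ### Smooth functions on `ℝⁿ` -/

/-- The set `C^∞(ℝⁿ)` of smooth real functions on `ℝⁿ`. -/
def SmoothFn (n : ℕ) : Type := {f : (Fin n → ℝ) → ℝ // ContDiff ℝ ∞ f}

namespace SmoothFn

instance (n : ℕ) : CoeFun (SmoothFn n) (fun _ => (Fin n → ℝ) → ℝ) := ⟨Subtype.val⟩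

theorem ext {n : ℕ} {f g : SmoothFn n} (h : ∀ x, f x = g x) : f = g :=
  Subtype.ext (funext h)

/-- The `i`-th coordinate function. -/
def proj {n : ℕ} (i : Fin n) : SmoothFn n := ⟨fun x => x i, by fun_prop⟩

/-- The composite of a smooth function `f` on `ℝᵐ` with a smooth map `g : ℝⁿ → ℝᵐ`. -/
def comp {n m : ℕ} (f : SmoothFn m) (g : Fin m → SmoothFn n) : SmoothFn n :=
  ⟨fun x => f (fun j => g j x), f.2.comp (contDiff_pi.2 fun j => (g j).2)⟩

/-- The constant function. -/
def const (n : ℕ) (c : ℝ) : SmoothFn n := ⟨fun _ => c, contDiff_const⟩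

/-- Addition `ℝ² → ℝ`. -/
def add : SmoothFn 2 := ⟨fun x => x 0 + x 1, by fun_prop⟩

/-- Multiplication `ℝ² → ℝ`. -/
def mul : SmoothFn 2 := ⟨fun x => x 0 * x 1, by fun_prop⟩

/-- Negation `ℝ → ℝ`. -/
def neg : SmoothFn 1 := ⟨fun x => - x 0, by fun_prop⟩

end SmoothFn

/-! ### `C^∞`-rings -/

/-- A `C^∞`-ring: a product preserving functor from the category of the `ℝⁿ` and smooth maps to
sets, given by its value `A` on `ℝ` and by the action on `A` of all smooth functions
`ℝⁿ → ℝ`, compatibly with projections and composition. -/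
class CInftyRing (A : Type u) where
  op : ∀ {n : ℕ}, SmoothFn n → (Fin n → A) → A
  op_proj : ∀ {n : ℕ} (i : Fin n) (a : Fin n → A), op (SmoothFn.proj i) a = a i
  op_comp : ∀ {n m : ℕ} (f : SmoothFn m) (g : Fin m → SmoothFn n) (a : Fin n → A),
    op (SmoothFn.comp f g) a = op f (fun j => op (g j) a)

namespace CInftyRing

/-- The `C^∞`-ring `ℝ`. -/
instance instReal : CInftyRing ℝ where
  op f a := f a
  op_proj _ _ := rfl
  op_comp _ _ _ := rfl

/-- The `C^∞`-ring `C^∞(ℝⁿ)`. -/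
instance instSmoothFn (n : ℕ) : CInftyRing (SmoothFn n) where
  op f g := SmoothFn.comp f g
  op_proj _ _ := rfl
  op_comp _ _ _ := rfl

/-- Morphisms of `C^∞`-rings. -/
@[ext]
structure Hom (A : Type u) (B : Type v) [CInftyRing A] [CInftyRing B] where
  toFun : A → B
  map_op : ∀ {n : ℕ} (f : SmoothFn n) (a : Fin n → A),
    toFun (op f a) = op f (fun i => toFun (a i))

instance (A : Type u) (B : Type v) [CInftyRing A] [CInftyRing B] :
    CoeFun (Hom A B) (fun _ => A → B) := ⟨Hom.toFun⟩

namespace Hom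

variable {A : Type u} {B : Type v} {C : Type w} [CInftyRing A] [CInftyRing B] [CInftyRing C]

/-- The identity. -/
def id (A : Type u) [CInftyRing A] : Hom A A := ⟨fun a => a, fun _ _ => rfl⟩

/-- Composition: first `f`, then `g`. -/
def comp (f : Hom A B) (g : Hom B C) : Hom A C :=
  ⟨fun a => g (f a), fun h a => by rw [f.map_op, g.map_op]⟩

end Hom

section Ring

set_option linter.unusedSimpArgs false
set_option linter.unnecessarySeqFocus false
set_option linter.unreachableTactic false
set_option linter.unusedTactic false

variable {A : Type u} [CInftyRing A]

theorem op_bin (h : SmoothFn 2) {n : ℕ} (f g : SmoothFn n) (x : Fin n → A) :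
    op h ![op f x, op g x] = op (SmoothFn.comp h ![f, g]) x := by
  rw [op_comp]; congr 1; funext i; fin_cases i <;> rfl

theorem op_un (h : SmoothFn 1) {n : ℕ} (f : SmoothFn n) (x : Fin n → A) :
    op h ![op f x] = op (SmoothFn.comp h ![f]) x := by
  rw [op_comp]; congr 1; funext i; fin_cases i; rfl

theorem op_const {n : ℕ} (c : ℝ) (x : Fin n → A) :
    op (SmoothFn.const 0 c) ![] = op (SmoothFn.const n c) x := by
  have : SmoothFn.const n c = SmoothFn.comp (SmoothFn.const 0 c) ![] := rfl
  rw [this, op_comp]; congr 1; funext i; exact i.elim0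

theorem ax_add_assoc (a b c : A) :
    op SmoothFn.add ![op SmoothFn.add ![a, b], c] = op SmoothFn.add ![a, op SmoothFn.add ![b, c]] := by
  have h : op SmoothFn.add ![op SmoothFn.add ![op (SmoothFn.proj 0) ![a, b, c], op (SmoothFn.proj 1) ![a, b, c]], op (SmoothFn.proj 2) ![a, b, c]] =
      op SmoothFn.add ![op (SmoothFn.proj 0) ![a, b, c], op SmoothFn.add ![op (SmoothFn.proj 1) ![a, b, c], op (SmoothFn.proj 2) ![a, b, c]]] := by
    simp only [op_bin, op_un]
    congr 1
    refine SmoothFn.ext fun x => ?_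
    simp [SmoothFn.comp, SmoothFn.add, SmoothFn.mul, SmoothFn.neg, SmoothFn.const,
      SmoothFn.proj] <;> ring
  simp only [op_proj] at h
  exact h

theorem ax_zero_add (a : A) :
    op SmoothFn.add ![op (SmoothFn.const 0 0) ![], a] = a := by
  have h : op SmoothFn.add ![op (SmoothFn.const 1 0) ![a], op (SmoothFn.proj 0) ![a]] =
      op (SmoothFn.proj 0) ![a] := by
    simp only [op_bin, op_un]
    congr 1
    refine SmoothFn.ext fun x => ?_
    simp [SmoothFn.comp, SmoothFn.add, SmoothFn.mul, SmoothFn.neg, SmoothFn.const,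
      SmoothFn.proj] <;> ring
  simp only [op_proj, ← op_const (n := 1)] at h
  exact h

theorem ax_neg_add (a : A) :
    op SmoothFn.add ![op SmoothFn.neg ![a], a] = op (SmoothFn.const 0 0) ![] := by
  have h : op SmoothFn.add ![op SmoothFn.neg ![op (SmoothFn.proj 0) ![a]], op (SmoothFn.proj 0) ![a]] =
      op (SmoothFn.const 1 0) ![a] := by
    simp only [op_bin, op_un]
    congr 1
    refine SmoothFn.ext fun x => ?_
    simp [SmoothFn.comp, SmoothFn.add, SmoothFn.mul, SmoothFn.neg, SmoothFn.const,
      SmoothFn.proj] <;> ring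
  simp only [op_proj, ← op_const (n := 1)] at h
  exact h

theorem ax_mul_assoc (a b c : A) :
    op SmoothFn.mul ![op SmoothFn.mul ![a, b], c] = op SmoothFn.mul ![a, op SmoothFn.mul ![b, c]] := by
  have h : op SmoothFn.mul ![op SmoothFn.mul ![op (SmoothFn.proj 0) ![a, b, c], op (SmoothFn.proj 1) ![a, b, c]], op (SmoothFn.proj 2) ![a, b, c]] =
      op SmoothFn.mul ![op (SmoothFn.proj 0) ![a, b, c], op SmoothFn.mul ![op (SmoothFn.proj 1) ![a, b, c], op (SmoothFn.proj 2) ![a, b, c]]] := by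
    simp only [op_bin, op_un]
    congr 1
    refine SmoothFn.ext fun x => ?_
    simp [SmoothFn.comp, SmoothFn.add, SmoothFn.mul, SmoothFn.neg, SmoothFn.const,
      SmoothFn.proj] <;> ring
  simp only [op_proj] at h
  exact h

theorem ax_mul_comm (a b : A) :
    op SmoothFn.mul ![a, b] = op SmoothFn.mul ![b, a] := by
  have h : op SmoothFn.mul ![op (SmoothFn.proj 0) ![a, b], op (SmoothFn.proj 1) ![a, b]] =
      op SmoothFn.mul ![op (SmoothFn.proj 1) ![a, b], op (SmoothFn.proj 0) ![a, b]] := by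
    simp only [op_bin, op_un]
    congr 1
    refine SmoothFn.ext fun x => ?_
    simp [SmoothFn.comp, SmoothFn.add, SmoothFn.mul, SmoothFn.neg, SmoothFn.const,
      SmoothFn.proj] <;> ring
  simp only [op_proj] at h
  exact h

theorem ax_one_mul (a : A) :
    op SmoothFn.mul ![op (SmoothFn.const 0 1) ![], a] = a := by
  have h : op SmoothFn.mul ![op (SmoothFn.const 1 1) ![a], op (SmoothFn.proj 0) ![a]] =
      op (SmoothFn.proj 0) ![a] := by
    simp only [op_bin, op_un]
    congr 1
    refine SmoothFn.ext fun x => ?_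
    simp [SmoothFn.comp, SmoothFn.add, SmoothFn.mul, SmoothFn.neg, SmoothFn.const,
      SmoothFn.proj] <;> ring
  simp only [op_proj, ← op_const (n := 1)] at h
  exact h

theorem ax_left_distrib (a b c : A) :
    op SmoothFn.mul ![a, op SmoothFn.add ![b, c]] = op SmoothFn.add ![op SmoothFn.mul ![a, b], op SmoothFn.mul ![a, c]] := by
  have h : op SmoothFn.mul ![op (SmoothFn.proj 0) ![a, b, c], op SmoothFn.add ![op (SmoothFn.proj 1) ![a, b, c], op (SmoothFn.proj 2) ![a, b, c]]] =
      op SmoothFn.add ![op SmoothFn.mul ![op (SmoothFn.proj 0) ![a, b, c], op (SmoothFn.proj 1) ![a, b, c]], op SmoothFn.mul ![op (SmoothFn.proj 0) ![a, b, c], op (SmoothFn.proj 2) ![a, b, c]]] := by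
    simp only [op_bin, op_un]
    congr 1
    refine SmoothFn.ext fun x => ?_
    simp [SmoothFn.comp, SmoothFn.add, SmoothFn.mul, SmoothFn.neg, SmoothFn.const,
      SmoothFn.proj] <;> ring
  simp only [op_proj] at h
  exact h

/-- The underlying commutative ring of a `C^∞`-ring: addition, multiplication, negation and the
constants `0`, `1` act through the corresponding smooth functions. -/
@[reducible]
def toCommRing (A : Type u) [CInftyRing A] : CommRing A :=
  letI : Add A := ⟨fun a b => op SmoothFn.add ![a, b]⟩
  letI : Mul A := ⟨fun a b => op SmoothFn.mul ![a, b]⟩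
  letI : Neg A := ⟨fun a => op SmoothFn.neg ![a]⟩
  letI : Zero A := ⟨op (SmoothFn.const 0 0) ![]⟩
  letI : One A := ⟨op (SmoothFn.const 0 1) ![]⟩
  CommRing.ofMinimalAxioms ax_add_assoc ax_zero_add ax_neg_add ax_mul_assoc ax_mul_comm
    ax_one_mul ax_left_distrib

end Ring

instance (n : ℕ) : CommRing (SmoothFn n) := toCommRing (SmoothFn n)

/-- A morphism of `C^∞`-rings is a homomorphism of the underlying rings. -/
def Hom.toRingHom {A : Type u} {B : Type v} [CInftyRing A] [CInftyRing B] (φ : Hom A B) :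
    letI := toCommRing A
    letI := toCommRing B
    A →+* B :=
  letI := toCommRing A
  letI := toCommRing B
  { toFun := φ
    map_one' := (φ.map_op _ _).trans (congrArg _ (funext fun i => i.elim0))
    map_zero' := (φ.map_op _ _).trans (congrArg _ (funext fun i => i.elim0))
    map_add' := fun a b =>
      (φ.map_op _ _).trans (congrArg _ (funext fun i => by fin_cases i <;> rfl))
    map_mul' := fun a b =>
      (φ.map_op _ _).trans (congrArg _ (funext fun i => by fin_cases i <;> rfl)) }

/-- The kernel of a morphism `C^∞(ℝⁿ) → A`. -/
def Hom.ker {n : ℕ} {A : Type u} [CInftyRing A] (φ : Hom (SmoothFn n) A) : Ideal (SmoothFn n) :=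
  letI := toCommRing A
  RingHom.ker φ.toRingHom

/-! ### Finitely generated and germ determined `C^∞`-rings -/

/-- `A` is finitely generated: a quotient of some `C^∞(ℝⁿ)`. -/
def IsFinitelyGenerated (A : Type u) [CInftyRing A] : Prop :=
  ∃ (n : ℕ) (φ : Hom (SmoothFn n) A), Function.Surjective φ

/-- An ideal `I` of `C^∞(ℝⁿ)` is germ determined if every `f ∉ I` has, at some point `p`, a germ
`f_p` that is not in `I_p`, the set of germs at `p` of elements of `I`. -/
def IsGermDeterminedIdeal {n : ℕ} (I : Ideal (SmoothFn n)) : Prop :=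
  ∀ f : SmoothFn n, f ∉ I → ∃ p : Fin n → ℝ, ¬ ∃ g ∈ I, f.1 =ᶠ[𝓝 p] g.1

/-- `A` is germ determined: `A ≅ C^∞(ℝⁿ)/I` for some `n` and some germ determined ideal `I`. -/
def IsGermDetermined (A : Type u) [CInftyRing A] : Prop :=
  ∃ (n : ℕ) (φ : Hom (SmoothFn n) A), Function.Surjective φ ∧ IsGermDeterminedIdeal φ.ker

/-! ### Localization of `C^∞`-rings

`Loc A S` is obtained from `A` by universally inverting the elements of `S` in the category of
`C^∞`-rings. It is built from generators and relations; `Loc.lift` and `Loc.hom_ext` are its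
universal property. -/

/-- The expressions built from elements of `A` and symbols `s⁻¹`, for `s ∈ S`, by the operations
of `C^∞`-rings. -/
inductive PreLoc (A : Type u) (S : Set A) : Type u
  | of : A → PreLoc A S
  | inv : S → PreLoc A S
  | op : {n : ℕ} → SmoothFn n → (Fin n → PreLoc A S) → PreLoc A S

/-- The congruence generated by the laws of `C^∞`-rings, the operations of `A` and
`s * s⁻¹ = 1`. -/
inductive PreLoc.Rel (A : Type u) [CInftyRing A] (S : Set A) : PreLoc A S → PreLoc A S → Prop
  | refl (x : PreLoc A S) : Rel A S x x
  | symm {x y : PreLoc A S} : Rel A S x y → Rel A S y x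
  | trans {x y z : PreLoc A S} : Rel A S x y → Rel A S y z → Rel A S x z
  | congr {n : ℕ} (f : SmoothFn n) {x y : Fin n → PreLoc A S} :
      (∀ i, Rel A S (x i) (y i)) → Rel A S (.op f x) (.op f y)
  | proj {n : ℕ} (i : Fin n) (x : Fin n → PreLoc A S) : Rel A S (.op (SmoothFn.proj i) x) (x i)
  | comp {n m : ℕ} (f : SmoothFn m) (g : Fin m → SmoothFn n) (x : Fin n → PreLoc A S) :
      Rel A S (.op (SmoothFn.comp f g) x) (.op f fun j => .op (g j) x)
  | of_op {n : ℕ} (f : SmoothFn n) (a : Fin n → A) :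
      Rel A S (.of (CInftyRing.op f a)) (.op f fun i => .of (a i))
  | mul_inv (s : S) :
      Rel A S (.op SmoothFn.mul ![.of s.1, .inv s]) (.op (SmoothFn.const 0 1) ![])

/-- `PreLoc.Rel` as a setoid. -/
def PreLoc.setoid (A : Type u) [CInftyRing A] (S : Set A) : Setoid (PreLoc A S) :=
  ⟨PreLoc.Rel A S, ⟨.refl, .symm, .trans⟩⟩

/-- The `C^∞`-ring obtained from `A` by universally inverting the elements of `S`. -/
def Loc (A : Type u) [CInftyRing A] (S : Set A) : Type u := Quotient (PreLoc.setoid A S)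

namespace Loc

variable {A : Type u} [CInftyRing A] {S : Set A} {B : Type v} [CInftyRing B]

/-- The class of an expression. -/
def mk (x : PreLoc A S) : Loc A S := Quotient.mk (PreLoc.setoid A S) x

theorem mk_eq {x y : PreLoc A S} (h : PreLoc.Rel A S x y) : mk x = mk y := Quotient.sound h

theorem mk_out (x : Loc A S) : mk (Quotient.out x) = x := Quotient.out_eq x

theorem rel_out (x : PreLoc A S) : PreLoc.Rel A S (Quotient.out (mk x)) x :=
  Quotient.exact (mk_out (mk x))

theorem mk_op_out {n : ℕ} (f : SmoothFn n) (x : Fin n → PreLoc A S) :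
    mk (.op f fun i => Quotient.out (mk (x i))) = mk (.op f x) :=
  mk_eq (.congr f fun i => rel_out (x i))

instance : CInftyRing (Loc A S) where
  op f x := mk (.op f fun i => Quotient.out (x i))
  op_proj i x := (mk_eq (.proj i _)).trans (mk_out _)
  op_comp f g x := (mk_eq (.comp f g _)).trans (mk_op_out f _).symm

theorem op_mk {n : ℕ} (f : SmoothFn n) (x : Fin n → PreLoc A S) :
    op f (fun i => mk (x i)) = mk (.op f x) := mk_op_out f x

variable (A S) in
/-- The canonical morphism `A → A{S⁻¹}`. -/
def of : Hom A (Loc A S) :=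
  ⟨fun a => mk (.of a), fun f a => (mk_eq (.of_op f a)).trans (op_mk f _).symm⟩

/-- `s` is a unit with inverse `t`. -/
def IsInv {C : Type w} [CInftyRing C] (s t : C) : Prop :=
  op SmoothFn.mul ![s, t] = op (SmoothFn.const 0 1) ![]

theorem IsInv.map {C : Type w} [CInftyRing C] {s t : C} (h : IsInv s t) (φ : Hom C B) :
    IsInv (φ s) (φ t) := by
  have := congrArg φ h
  rw [φ.map_op, φ.map_op] at this
  refine Eq.trans (congrArg _ ?_) (this.trans (congrArg _ ?_))
  · funext i; fin_cases i <;> rfl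
  · funext i; exact i.elim0

theorem IsInv.unique {C : Type w} [CInftyRing C] {s t t' : C} (h : IsInv s t) (h' : IsInv s t') :
    t = t' := by
  let _ := toCommRing C
  have h1 : s * t = 1 := h
  have h2 : s * t' = 1 := h'
  calc t = t * (s * t') := by rw [h2, mul_one]
    _ = (s * t) * t' := by ring
    _ = t' := by rw [h1, one_mul]

theorem isInv_of (s : S) : IsInv (of A S s.1) (mk (.inv s)) := by
  refine Eq.trans ?_ ((mk_eq (.mul_inv s)).trans ?_)
  · refine Eq.trans (congrArg _ ?_) (op_mk _ _)
    funext i; fin_cases i <;> rfl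
  · refine Eq.trans (op_mk _ _).symm (congrArg _ ?_)
    funext i; exact i.elim0

/-- Evaluation of expressions in `B`. -/
def evalPre (φ : Hom A B) (h : ∀ s : S, ∃ t, IsInv (φ s.1) t) : PreLoc A S → B
  | .of a => φ a
  | .inv s => (h s).choose
  | .op f x => CInftyRing.op f fun i => evalPre φ h (x i)

theorem evalPre_rel (φ : Hom A B) (h : ∀ s : S, ∃ t, IsInv (φ s.1) t) {x y : PreLoc A S}
    (hxy : PreLoc.Rel A S x y) : evalPre φ h x = evalPre φ h y := by
  induction hxy with
  | refl => rfl
  | symm _ ih => exact ih.symm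
  | trans _ _ ih ih' => exact ih.trans ih'
  | congr f _ ih => exact congrArg (CInftyRing.op f) (funext ih)
  | proj i _ => exact op_proj _ _
  | comp f g _ => exact op_comp _ _ _
  | of_op f a => exact φ.map_op f a
  | mul_inv s =>
    refine Eq.trans (congrArg (CInftyRing.op SmoothFn.mul) ?_)
      ((h s).choose_spec.trans (congrArg (CInftyRing.op (SmoothFn.const 0 1)) ?_))
    · funext i; fin_cases i <;> rfl
    · funext i; exact i.elim0

/-- The universal property, existence: a morphism `A → B` that makes the elements of `S`
invertible factors through `A{S⁻¹}`. -/
def lift (φ : Hom A B) (h : ∀ s : S, ∃ t, IsInv (φ s.1) t) : Hom (Loc A S) B where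
  toFun := Quotient.lift (s := PreLoc.setoid A S) (evalPre φ h) fun _ _ => evalPre_rel φ h
  map_op f x := by
    obtain ⟨y, rfl⟩ : ∃ y : Fin _ → PreLoc A S, x = fun i => mk (y i) :=
      ⟨fun i => Quotient.out (x i), funext fun i => (mk_out _).symm⟩
    rw [op_mk]
    rfl

theorem lift_of (φ : Hom A B) (h : ∀ s : S, ∃ t, IsInv (φ s.1) t) (a : A) :
    lift φ h (of A S a) = φ a := rfl

/-- The universal property, uniqueness. -/
theorem hom_ext {φ ψ : Hom (Loc A S) B} (h : ∀ a, φ (of A S a) = ψ (of A S a)) : φ = ψ := by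
  suffices ∀ x : PreLoc A S, φ (mk x) = ψ (mk x) from
    Hom.ext (funext fun x => by rw [← mk_out x]; exact this _)
  intro x
  induction x with
  | of a => exact h a
  | inv s =>
    have hφ := (isInv_of s).map φ
    rw [h] at hφ
    exact hφ.unique ((isInv_of s).map ψ)
  | op f x ih =>
    rw [← op_mk, φ.map_op, ψ.map_op]
    exact congrArg _ (funext ih)

/-- The morphism `A{S⁻¹} → B{T⁻¹}` induced by a morphism `A → B` that maps `S` into `T`. -/
def map {T : Set B} (φ : Hom A B) (h : ∀ a ∈ S, φ a ∈ T) : Hom (Loc A S) (Loc B T) :=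
  lift (φ.comp (of B T)) fun s => ⟨_, isInv_of ⟨φ s.1, h s.1 s.2⟩⟩

theorem map_of {T : Set B} (φ : Hom A B) (h : ∀ a ∈ S, φ a ∈ T) (a : A) :
    map φ h (of A S a) = of B T (φ a) := rfl

theorem map_id (h : ∀ a ∈ S, Hom.id A a ∈ S) (x : Loc A S) : map (Hom.id A) h x = x :=
  congrArg (fun ψ : Hom (Loc A S) (Loc A S) => ψ x)
    (hom_ext (φ := map (Hom.id A) h) (ψ := Hom.id _) fun _ => rfl)

theorem map_map {C : Type w} [CInftyRing C] {T : Set B} {R : Set C} (φ : Hom A B) (ψ : Hom B C)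
    (h : ∀ a ∈ S, φ a ∈ T) (h' : ∀ b ∈ T, ψ b ∈ R) (h'' : ∀ a ∈ S, φ.comp ψ a ∈ R)
    (x : Loc A S) : map ψ h' (map φ h x) = map (φ.comp ψ) h'' x :=
  congrArg (fun χ : Hom (Loc A S) (Loc C R) => χ x)
    (hom_ext (φ := (map φ h).comp (map ψ h')) (ψ := map (φ.comp ψ) h'') fun _ => rfl)

end Loc

/-! ### The spectrum of a `C^∞`-ring -/

/-- The set `Sp(A)` of morphisms of `C^∞`-rings `A → ℝ`. -/
abbrev Sp (A : Type u) [CInftyRing A] : Type u := Hom A ℝ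

namespace Sp

variable {A : Type u} [CInftyRing A] {B : Type v} [CInftyRing B]

/-- The value at a point `p` of `Sp(A)` of an element `a` of `A`. -/
def eval (p : Sp A) (a : A) : ℝ := Hom.toFun p a

/-- The basic set `U_a` of the points where `a` does not vanish. -/
def basicOpen (a : A) : Set (Sp A) := {p | p.eval a ≠ 0}

/-- The Zariski topology. -/
instance : TopologicalSpace (Sp A) := TopologicalSpace.generateFrom (Set.range basicOpen)

/-- The elements that vanish nowhere on `U_a`. -/
def nonvanishingOn (a : A) : Set A := {a' | ∀ p : Sp A, p.eval a ≠ 0 → p.eval a' ≠ 0}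

/-- The smooth localization `A{a⁻¹}`: all elements that vanish nowhere on `U_a` are inverted. -/
abbrev SmoothLoc (a : A) : Type u := Loc A (nonvanishingOn a)

/-- The elements that do not vanish at `p`. -/
def nonvanishingAt (p : Sp A) : Set A := {a | p.eval a ≠ 0}

/-- The localization of `A` at `p`; it is the colimit of the `A{a⁻¹}` over all `a` with
`p ∈ U_a`. -/
abbrev LocAt (p : Sp A) : Type u := Loc A (nonvanishingAt p)

/-- The canonical morphism `A{a⁻¹} → A_p`, for `p ∈ U_a`. -/
def toLocAt (a : A) (p : Sp A) (hp : p ∈ basicOpen a) : Hom (SmoothLoc a) (LocAt p) :=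
  Loc.map (Hom.id A) fun _ ha' => ha' p hp

/-- The family `s` of elements of the localizations at the points of `U` is locally given by
elements of the smooth localizations `A{a⁻¹}`. -/
def IsLocallyFraction (U : Opens (Sp A)) (s : ∀ p : U, LocAt p.1) : Prop :=
  ∀ p : U, ∃ (a : A) (_ : p.1 ∈ basicOpen a) (x : SmoothLoc a),
    ∀ (q : U) (hq : q.1 ∈ basicOpen a), s q = toLocAt a q.1 hq x

/-- The sections over `U` of the sheaf associated to `U_a ↦ A{a⁻¹}`. -/
abbrev Sections (U : Opens (Sp A)) : Type u := {s : ∀ p : U, LocAt p.1 // IsLocallyFraction U s}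

theorem eval_op (p : Sp A) {n : ℕ} (f : SmoothFn n) (a : Fin n → A) :
    p.eval (op f a) = f fun i => p.eval (a i) := Hom.map_op p f a

theorem nonvanishingOn_mono {a b : A} (h : basicOpen b ⊆ basicOpen a) :
    ∀ a' ∈ nonvanishingOn a, Hom.id A a' ∈ nonvanishingOn b := fun _ ha' q hq => ha' q (h hq)

theorem map_nonvanishingOn (φ : Hom A B) (a : A) :
    ∀ a' ∈ nonvanishingOn a, φ a' ∈ nonvanishingOn (φ a) :=
  fun _ ha' q hq => ha' (Hom.comp φ q) hq

/-- The product of `n` real numbers. -/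
def prodFn (n : ℕ) : SmoothFn n := ⟨fun x => ∏ i, x i, by fun_prop⟩

theorem eval_prod_ne_zero (p : Sp A) {n : ℕ} (a : Fin n → A) :
    p.eval (op (prodFn n) a) ≠ 0 ↔ ∀ i, p.eval (a i) ≠ 0 := by
  rw [eval_op]
  simp [prodFn, Finset.prod_ne_zero_iff]

theorem isLocallyFraction_op {U : Opens (Sp A)} {n : ℕ} (f : SmoothFn n)
    (s : Fin n → Sections U) : IsLocallyFraction U fun p => op f fun i => (s i).1 p := by
  intro p
  choose a ha x hx using fun i => (s i).2 p
  have key : ∀ i (q : Sp A), q.eval (op (prodFn n) a) ≠ 0 → q.eval (a i) ≠ 0 :=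
    fun i q hq => (eval_prod_ne_zero q a).1 hq i
  refine ⟨op (prodFn n) a, (eval_prod_ne_zero p.1 a).2 ha,
    op f fun i => Loc.map (Hom.id A) (nonvanishingOn_mono (key i)) (x i), ?_⟩
  intro q hq
  refine Eq.trans (congrArg (op f) (funext fun i => ?_))
    (Hom.map_op (toLocAt (op (prodFn n) a) q.1 hq) f _).symm
  refine (hx i q (key i q.1 hq)).trans ?_
  exact (Loc.map_map (Hom.id A) (Hom.id A) (nonvanishingOn_mono (key i)) (fun _ ha' => ha' q.1 hq)
    (fun _ ha' => ha' q.1 (key i q.1 hq)) (x i)).symm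

instance (U : Opens (Sp A)) : CInftyRing (Sections U) where
  op f s := ⟨fun p => op f fun i => (s i).1 p, isLocallyFraction_op f s⟩
  op_proj i s := Subtype.ext (funext fun p => op_proj i fun i => (s i).1 p)
  op_comp f g s := Subtype.ext (funext fun p => op_comp f g fun i => (s i).1 p)

/-- Restriction of sections. -/
def res {U V : Opens (Sp A)} (h : V ≤ U) : Hom (Sections U) (Sections V) where
  toFun s := ⟨fun p => s.1 ⟨p.1, h p.2⟩, fun p => by
    obtain ⟨a, ha, x, hx⟩ := s.2 ⟨p.1, h p.2⟩
    exact ⟨a, ha, x, fun q hq => hx ⟨q.1, h q.2⟩ hq⟩⟩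
  map_op _ _ := rfl

/-- The map `Sp(B) → Sp(A)` induced by a morphism `A → B`. -/
def comap (φ : Hom A B) (p : Sp B) : Sp A := Hom.comp φ p

theorem continuous_comap (φ : Hom A B) : Continuous (comap φ) := by
  refine continuous_generateFrom_iff.2 ?_
  rintro _ ⟨a, rfl⟩
  exact TopologicalSpace.isOpen_generateFrom_of_mem ⟨φ a, rfl⟩

/-- The morphism `A_{p ∘ φ} → B_p` induced by `φ : A → B`. -/
def locAtMap (φ : Hom A B) (p : Sp B) : Hom (LocAt (comap φ p)) (LocAt p) :=
  Loc.map φ fun _ ha => ha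

/-- The morphism on sections induced by `φ : A → B`. -/
def sectionsMap (φ : Hom A B) (U : Opens (Sp A)) (V : Opens (Sp B))
    (h : ∀ p ∈ V, comap φ p ∈ U) : Hom (Sections U) (Sections V) where
  toFun s := ⟨fun p => locAtMap φ p.1 (s.1 ⟨comap φ p.1, h p.1 p.2⟩), fun p => by
    obtain ⟨a, ha, x, hx⟩ := s.2 ⟨comap φ p.1, h p.1 p.2⟩
    refine ⟨φ a, ha, Loc.map φ (map_nonvanishingOn φ a) x, fun q hq => ?_⟩
    refine (congrArg _ (hx ⟨comap φ q.1, h q.1 q.2⟩ hq)).trans ?_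
    have h1 : ∀ a' ∈ nonvanishingOn a, φ a' ∈ nonvanishingAt q.1 :=
      fun a' ha' => ha' (comap φ q.1) hq
    have h2 : ∀ a' ∈ nonvanishingOn a, Hom.id A a' ∈ nonvanishingAt (comap φ q.1) :=
      fun a' ha' => ha' (comap φ q.1) hq
    have h3 : ∀ b ∈ nonvanishingOn (φ a), Hom.id B b ∈ nonvanishingAt q.1 :=
      fun b hb => hb q.1 hq
    exact (Loc.map_map (Hom.id A) φ h2 (fun _ ha => ha) h1 x).trans
      (Loc.map_map φ (Hom.id B) (map_nonvanishingOn φ a) h3 h1 x).symm⟩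
  map_op f s := Subtype.ext (funext fun p =>
    (locAtMap φ p.1).map_op f fun i => (s i).1 ⟨comap φ p.1, h p.1 p.2⟩)

end Sp

end CInftyRing

/-! ### The category of `C^∞`-rings -/

/-- The category of `C^∞`-rings. -/
structure CInftyRingCat : Type (u + 1) where
  carrier : Type u
  [str : CInftyRing carrier]

namespace CInftyRingCat

instance : CoeSort CInftyRingCat.{u} (Type u) := ⟨carrier⟩

instance (A : CInftyRingCat.{u}) : CInftyRing A := A.str

instance : Category CInftyRingCat.{u} where
  Hom A B := CInftyRing.Hom A B
  id A := CInftyRing.Hom.id A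
  comp f g := CInftyRing.Hom.comp f g

/-- The functor that sends a `C^∞`-ring to its underlying commutative ring. -/
def toCommRingCat : CInftyRingCat.{u} ⥤ CommRingCat.{u} where
  obj A := @CommRingCat.of A (CInftyRing.toCommRing A)
  map {A B} f :=
    letI := CInftyRing.toCommRing A
    letI := CInftyRing.toCommRing B
    CommRingCat.ofHom (CInftyRing.Hom.toRingHom f)

/-- The full subcategory of finitely generated germ determined `C^∞`-rings. -/
def isGeometric : ObjectProperty CInftyRingCat.{u} := fun A =>
  CInftyRing.IsFinitelyGenerated A ∧ CInftyRing.IsGermDetermined A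

end CInftyRingCat

/-! ### `C^∞`-spaces -/

namespace CInftySpace

open AlgebraicGeometry

/-- Softness: every section over a closed subset `Z` extends to a global section. A section over
`Z` is a family of elements of the stalks at the points of `Z` that is, near each point of `Z`,
induced by a section over an open set. -/
def IsSoft {X : TopCat.{u}} (F : X.Presheaf CommRingCat.{u}) : Prop :=
  ∀ (Z : Set X), IsClosed Z → ∀ s : ∀ z : Z, F.stalk z.1,
    (∀ z : Z, ∃ (U : Opens X) (_ : z.1 ∈ U) (t : F.obj (op U)),
      ∀ (w : Z) (hw : w.1 ∈ U), F.germ U w.1 hw t = s w) →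
    ∃ t : F.obj (op ⊤), ∀ z : Z, F.germ ⊤ z.1 trivial t = s z

/-- A ring with a unique maximal ideal and with residue field `ℝ`. -/
def IsLocalWithResidueFieldReal (R : Type u) [CommRing R] : Prop :=
  ∃ _ : IsLocalRing R, Nonempty (IsLocalRing.ResidueField R ≃+* ℝ)

/-- The underlying presheaf of rings of a space with a presheaf of `C^∞`-rings. -/
abbrev ringPresheaf (X : PresheafedSpace CInftyRingCat.{u}) : X.carrier.Presheaf CommRingCat.{u} :=
  X.presheaf ⋙ CInftyRingCat.toCommRingCat

/-- The conditions that make a space with a presheaf of `C^∞`-rings a `C^∞`-space. Being a sheaf,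
being soft, and having local stalks with residue field `ℝ` are conditions on the underlying
presheaf of rings. -/
structure IsCInftySpace (X : PresheafedSpace CInftyRingCat.{u}) : Prop where
  t2 : T2Space X
  isSheaf : (ringPresheaf X).IsSheaf
  soft : IsSoft (ringPresheaf X)
  finitelyGenerated : ∀ U : Opens X, CInftyRing.IsFinitelyGenerated (X.presheaf.obj (op U))
  isLocal : ∀ x : X, IsLocalWithResidueFieldReal ((ringPresheaf X).stalk x)

/-- The property of being a `C^∞`-space, on the category of spaces with a presheaf of
`C^∞`-rings. -/
def isCInftySpace : ObjectProperty (PresheafedSpace CInftyRingCat.{u}) := IsCInftySpace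

/-- The spectrum of a `C^∞`-ring, with its structure sheaf. -/
def SpObj (A : CInftyRingCat.{u}) : PresheafedSpace CInftyRingCat.{u} where
  carrier := TopCat.of (CInftyRing.Sp A)
  presheaf :=
    { obj := fun U => ⟨CInftyRing.Sp.Sections U.unop⟩
      map := fun i => CInftyRing.Sp.res i.unop.le }

/-- The morphism of spectra induced by a morphism of `C^∞`-rings `A → B`. -/
def SpMap {A B : CInftyRingCat.{u}} (φ : A ⟶ B) : SpObj B ⟶ SpObj A where
  base := TopCat.ofHom ⟨CInftyRing.Sp.comap φ, CInftyRing.Sp.continuous_comap φ⟩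
  c :=
    { app := fun _ => CInftyRing.Sp.sectionsMap φ _ _ fun _ h => h
      naturality := fun U V i => by
        refine CInftyRing.Hom.ext (funext fun s => ?_)
        refine Subtype.ext (funext fun p => ?_)
        rfl }

/-- The functor `Sp` that sends a `C^∞`-ring `A` to `Sp(A)` with its structure sheaf. -/
def spFunctor : CInftyRingCat.{u}ᵒᵖ ⥤ PresheafedSpace CInftyRingCat.{u} where
  obj A := SpObj A.unop
  map φ := SpMap φ.unop
  map_id A := by
    refine PresheafedSpace.ext _ _ (TopCat.ext fun p => ?_) (NatTrans.ext (funext fun U => ?_))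
    · rfl
    refine CInftyRing.Hom.ext (funext fun s => Subtype.ext (funext fun p => ?_))
    exact CInftyRing.Loc.map_id (S := CInftyRing.Sp.nonvanishingAt p.1) (fun _ h => h) (s.1 p)
  map_comp φ ψ := by
    refine PresheafedSpace.ext _ _ rfl (NatTrans.ext (funext fun U => ?_))
    refine CInftyRing.Hom.ext (funext fun s => Subtype.ext (funext fun p => ?_))
    exact (CInftyRing.Loc.map_map
      (S := CInftyRing.Sp.nonvanishingAt (CInftyRing.Sp.comap (CInftyRing.Hom.comp ψ.unop φ.unop) p.1))
      (T := CInftyRing.Sp.nonvanishingAt (CInftyRing.Sp.comap φ.unop p.1))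
      (R := CInftyRing.Sp.nonvanishingAt p.1) ψ.unop φ.unop (fun _ h => h) (fun _ h => h)
      (fun _ h => h) (s.1 ⟨CInftyRing.Sp.comap (CInftyRing.Hom.comp ψ.unop φ.unop) p.1, p.2⟩)).symm

/-- The functor of global sections, from `C^∞`-spaces to the opposite of the category of finitely
generated germ determined `C^∞`-rings, given that its values lie there. -/
def gammaG
    (h : ∀ X : isCInftySpace.{u}.FullSubcategory,
      CInftyRingCat.isGeometric (PresheafedSpace.Γ.obj (op X.obj))) :
    isCInftySpace.{u}.FullSubcategory ⥤ CInftyRingCat.isGeometric.{u}.FullSubcategoryᵒᵖ :=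
  (CInftyRingCat.isGeometric.lift (isCInftySpace.ι.op ⋙ PresheafedSpace.Γ)
    fun X => h X.unop).rightOp

/-- The functor `Sp`, from the opposite of the category of finitely generated germ determined
`C^∞`-rings to `C^∞`-spaces, given that its values lie there. -/
def spG
    (h : ∀ A : CInftyRingCat.isGeometric.{u}.FullSubcategory,
      isCInftySpace (spFunctor.obj (op A.obj))) :
    CInftyRingCat.isGeometric.{u}.FullSubcategoryᵒᵖ ⥤ isCInftySpace.{u}.FullSubcategory :=
  isCInftySpace.lift (CInftyRingCat.isGeometric.ι.op ⋙ spFunctor) fun A => h A.unop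

end CInftySpace

end

noncomputable section

/-! ### Analysis on `ℝⁿ`: Hadamard's lemma, bump functions, partitions of unity. -/

section SmoothFunctions

open Filter MeasureTheory

/-! Bump functions make denominators superfluous. An element of `A` that does not vanish at `p` has
an inverse near `p` that is itself an element of `A` (`Sp.exists_inv`), so `A → A_p` is onto, two
elements agree in `A_p` exactly when some `b` with `p(b) ≠ 0` equalizes them (`Sp.of_eq_of_iff`),
and sections of the structure sheaf are locally given by elements of `A` (`Sp.exists_of_section`).
The algebraic input is Hadamard's lemma: every ring ideal is a congruence for all smooth operations.

If `A` is a quotient of `C^∞(ℝⁿ)`, then `Sp(A)` is the closed zero set of the kernel in `ℝⁿ`, and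
partitions of unity glue local representatives to elements of `A`. This gives softness and the
surjectivity of `A → Γ(Sp(A))`; germ determinacy gives its injectivity. An open set `{φ ≠ 0}`
becomes closed in `ℝⁿ⁺¹` through `x ↦ (x, 1/φ(x))`, so the same gluing shows that its ring of
sections is finitely generated.

For a `C^∞`-space `X`, softness replaces bump functions by separating global sections. The value at
a point of `X` is a ring homomorphism `Γ(X) → ℝ`, hence a morphism of `C^∞`-rings, because ring
homomorphisms `C^∞(ℝⁿ) → ℝ` are evaluations. The map `X → Sp(Γ(X))` so obtained is onto by a sum of
squares argument and is a homeomorphism. The localization of `Γ(X)` at a point has the same elements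
as the stalk (`of_point_eq_iff`, `exists_germ_top_eq`), so the two sheaves agree. Morphisms of
`C^∞`-spaces respect values automatically, whence naturality. -/

theorem SmoothFn.contDiff {n : ℕ} (f : SmoothFn n) : ContDiff ℝ ∞ (f : (Fin n → ℝ) → ℝ) := f.2

theorem SmoothFn.continuous {n : ℕ} (f : SmoothFn n) : Continuous (f : (Fin n → ℝ) → ℝ) :=
  f.contDiff.continuous

/-- A smooth function, as an element of `C^∞(ℝⁿ)`. -/
def SmoothFn.mk {n : ℕ} (f : (Fin n → ℝ) → ℝ) (hf : ContDiff ℝ ∞ f) : SmoothFn n := ⟨f, hf⟩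

/-- The integral over `[0, 1]` of a smooth function with smooth parameters is smooth. -/
theorem contDiff_parametric_integral {P : Type*} [NormedAddCommGroup P] [NormedSpace ℝ P]
    (F : P × ℝ → ℝ) (hF : ContDiff ℝ ∞ F) :
    ContDiff ℝ ∞ fun p => ∫ t in (0 : ℝ)..1, F (p, t) := by
  -- The integral is the convolution at `0` of the indicator of `(0, 1]` with `t ↦ χ t * F (p, -t)`.
  -- The cutoff `χ` supplies the compact support and must be `1` on `[-1, 0]`, where `-t` lies for
  -- `t` in the interval.
  obtain ⟨χ, -, hχc, hχ, -, hχ1⟩ :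
      ∃ f : ℝ → ℝ, tsupport f ⊆ Set.univ ∧ HasCompactSupport f ∧ ContDiff ℝ ∞ f ∧
        Set.range f ⊆ Set.Icc 0 1 ∧ ∀ t ∈ Set.Icc (-1 : ℝ) 0, f t = 1 := by
    let b : ContDiffBump (0 : ℝ) := ⟨1, 2, one_pos, one_lt_two⟩
    refine ⟨b, Set.subset_univ _, b.hasCompactSupport, b.contDiff, ?_, fun t ht => ?_⟩
    · rintro _ ⟨y, rfl⟩
      exact ⟨b.nonneg, b.le_one⟩
    · refine b.one_of_mem_closedBall ?_
      rw [Metric.mem_closedBall, Real.dist_eq, sub_zero, abs_le]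
      exact ⟨ht.1, ht.2.trans zero_le_one⟩
  let f : ℝ → ℝ := Set.indicator (Set.Ioc 0 1) fun _ => 1
  have hf : LocallyIntegrable f :=
    ((integrable_indicator_iff measurableSet_Ioc).2 (by simp)).locallyIntegrable
  have key := contDiffOn_convolution_right_with_param_comp (μ := volume) (n := ⊤)
    (ContinuousLinearMap.mul ℝ ℝ) (s := (Set.univ : Set P)) (v := fun _ => (0 : ℝ))
    contDiffOn_const (f := f) (g := fun p t => χ t * F (p, -t)) isOpen_univ hχc
    (fun p t _ ht => by
      change χ t * F (p, -t) = 0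
      rw [image_eq_zero_of_notMem_tsupport ht, zero_mul]) hf
    (by
      apply ContDiff.contDiffOn
      exact (hχ.comp contDiff_snd).mul (hF.comp (contDiff_fst.prodMk contDiff_snd.neg)))
  rw [contDiffOn_univ] at key
  convert! key using 2 with p
  rw [convolution_def, intervalIntegral.integral_of_le zero_le_one,
    ← integral_indicator measurableSet_Ioc]
  congr 1
  funext t
  by_cases ht : t ∈ Set.Ioc (0 : ℝ) 1
  · simp [f, Set.indicator_of_mem ht,
      hχ1 (-t) ⟨by linarith [ht.2], by linarith [ht.1]⟩]
  · simp [f, Set.indicator_of_notMem ht]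

/-- Integrate the derivative of `f` along the segment from `y` to `x` and expand `x - y` in the
standard basis. The `g i` are smooth in `x` and `y` jointly, so they act as operations in `n + n`
variables on any `C^∞`-ring. -/
theorem exists_hadamard {n : ℕ} {f : (Fin n → ℝ) → ℝ} (hf : ContDiff ℝ ∞ f) :
    ∃ g : Fin n → SmoothFn (n + n), ∀ x y : Fin n → ℝ,
      f x - f y = ∑ i, (x i - y i) * g i (Fin.append x y) := by
  let l : (Fin (n + n) → ℝ) → (Fin n → ℝ) := fun z i => z (Fin.castAdd n i)
  let r : (Fin (n + n) → ℝ) → (Fin n → ℝ) := fun z i => z (Fin.natAdd n i)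
  have hl : ContDiff ℝ ∞ l := by fun_prop
  have hr : ContDiff ℝ ∞ r := by fun_prop
  have hD : ContDiff ℝ ∞ (fderiv ℝ f) := hf.fderiv_right (by simp)
  have hG (i : Fin n) : ContDiff ℝ ∞ fun q : (Fin (n + n) → ℝ) × ℝ =>
      fderiv ℝ f (r q.1 + q.2 • (l q.1 - r q.1)) (Pi.single i 1) := by
    refine (hD.comp ?_).clm_apply contDiff_const
    have h1 := hl.comp (contDiff_fst (𝕜 := ℝ) (n := ∞) (E := Fin (n + n) → ℝ) (F := ℝ))
    have h2 := hr.comp (contDiff_fst (𝕜 := ℝ) (n := ∞) (E := Fin (n + n) → ℝ) (F := ℝ))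
    exact h2.add (contDiff_snd.smul (h1.sub h2))
  refine ⟨fun i => SmoothFn.mk _ (contDiff_parametric_integral _ (hG i)), fun x y => ?_⟩
  have hlx : l (Fin.append x y) = x := funext fun i => Fin.append_left x y i
  have hrx : r (Fin.append x y) = y := funext fun i => Fin.append_right x y i
  have hderiv (t : ℝ) : HasDerivAt (fun t : ℝ => f (y + t • (x - y)))
      (fderiv ℝ f (y + t • (x - y)) (x - y)) t := by
    have h1 : HasDerivAt (fun t : ℝ => y + t • (x - y)) (x - y) t := by
      simpa using ((hasDerivAt_id t).smul_const (x - y)).const_add y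
    exact (hf.differentiable (by simp) _).hasFDerivAt.comp_hasDerivAt t h1
  have hcont : Continuous fun t : ℝ => fderiv ℝ f (y + t • (x - y)) :=
    hD.continuous.comp (by fun_prop)
  have hint := intervalIntegral.integral_eq_sub_of_hasDerivAt (a := 0) (b := 1)
    (fun t _ => hderiv t) ((hcont.clm_apply continuous_const).intervalIntegrable _ _)
  simp only [one_smul, add_sub_cancel, zero_smul, add_zero] at hint
  rw [← hint]
  change _ = ∑ i, (x i - y i) * ∫ t in (0 : ℝ)..1, fderiv ℝ f _ _
  simp_rw [hlx, hrx, ← intervalIntegral.integral_const_mul]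
  have hI : ∀ i ∈ Finset.univ, IntervalIntegrable
      (fun t : ℝ => (x i - y i) * fderiv ℝ f (y + t • (x - y)) (Pi.single i 1)) volume 0 1 :=
    fun i _ => (continuous_const.mul (hcont.clm_apply continuous_const)).intervalIntegrable _ _
  rw [← intervalIntegral.integral_finsetSum hI]
  congr 1
  funext t
  refine (congrArg (fderiv ℝ f (y + t • (x - y))) (pi_eq_sum_univ' (x - y))).trans ?_
  simp [map_sum]

/-- **Hadamard's lemma**. -/
theorem SmoothFn.hadamard {n : ℕ} (f : SmoothFn n) :
    ∃ g : Fin n → SmoothFn (n + n), ∀ x y : Fin n → ℝ,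
      f x - f y = ∑ i, (x i - y i) * g i (Fin.append x y) := exists_hadamard f.2

namespace SmoothFn

theorem exists_bump {n : ℕ} {x : Fin n → ℝ} {W : Set (Fin n → ℝ)} (hW : W ∈ 𝓝 x) :
    ∃ b : SmoothFn n, b.1 =ᶠ[𝓝 x] (fun _ => 1) ∧ ∀ y, y ∉ W → b y = 0 := by
  obtain ⟨ε, hε, hb⟩ := Metric.mem_nhds_iff.1 hW
  let b : ContDiffBump x := ⟨ε / 2, ε, half_pos hε, half_lt_self hε⟩
  refine ⟨⟨b, b.contDiff⟩, b.eventuallyEq_one, fun y hy => ?_⟩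
  have : y ∉ Function.support b := fun h => hy (hb (by rwa [b.support_eq] at h))
  simpa using this

/-- Take `b / f` for a bump function `b` whose closed support lies where `f ≠ 0`: it vanishes near
the zeros of `f` and equals `1 / f` near `x`. -/
theorem exists_inv {n : ℕ} (f : SmoothFn n) {x : Fin n → ℝ} (hx : f x ≠ 0) :
    ∃ g : SmoothFn n, ∀ᶠ y in 𝓝 x, f y * g y = 1 := by
  have hW : {y | f y ≠ 0} ∈ 𝓝 x := f.continuous.continuousAt.eventually_ne hx
  obtain ⟨ε, hε, hb⟩ := Metric.mem_nhds_iff.1 hW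
  let b : ContDiffBump x := ⟨ε / 3, ε / 2, by positivity, by linarith⟩
  refine ⟨⟨fun y => b y / f y, ?_⟩, ?_⟩
  · rw [contDiff_iff_contDiffAt]
    intro y
    by_cases hy : f y = 0
    · have : (fun y => b y / f y) =ᶠ[𝓝 y] fun _ => 0 := by
        have hy' : y ∉ tsupport b := fun h => by
          rw [b.tsupport_eq] at h
          refine hb (Metric.closedBall_subset_ball (half_lt_self hε) h) hy
        filter_upwards [(isClosed_tsupport b).isOpen_compl.mem_nhds hy'] with z hz
        rw [image_eq_zero_of_notMem_tsupport hz, zero_div]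
      exact contDiffAt_const.congr_of_eventuallyEq this
    · exact (b.contDiff.contDiffAt).div f.contDiff.contDiffAt hy
  · filter_upwards [b.eventuallyEq_one, hW] with y hy hfy
    rw [hy, Pi.one_apply]
    exact mul_one_div_cancel hfy

/-- Because of this the topology generated by the `U_a` is as fine as the Euclidean one. -/
theorem exists_support {n : ℕ} {W : Set (Fin n → ℝ)} (hW : IsOpen W) :
    ∃ φ : SmoothFn n, ∀ x, φ x ≠ 0 ↔ x ∈ W := by
  obtain ⟨f, hf, hs, -⟩ := hW.exists_contDiff_support_eq (n := ⊤)
  exact ⟨⟨f, hs⟩, fun x => by rw [← hf]; rfl⟩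

/-- Evaluation at a point, as a ring homomorphism. -/
def evalAt {n : ℕ} (x : Fin n → ℝ) : SmoothFn n →+* ℝ where
  toFun f := f x
  map_one' := rfl
  map_zero' := rfl
  map_add' _ _ := rfl
  map_mul' _ _ := rfl

theorem sum_apply {n : ℕ} {ι : Type*} (s : Finset ι) (f : ι → SmoothFn n) (x : Fin n → ℝ) :
    (∑ i ∈ s, f i) x = ∑ i ∈ s, f i x := map_sum (evalAt x) f s

theorem mul_apply {n : ℕ} (f g : SmoothFn n) (x : Fin n → ℝ) : (f * g) x = f x * g x := rfl

theorem add_apply {n : ℕ} (f g : SmoothFn n) (x : Fin n → ℝ) : (f + g) x = f x + g x := rfl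

theorem sub_apply {n : ℕ} (f g : SmoothFn n) (x : Fin n → ℝ) : (f - g) x = f x - g x :=
  map_sub (evalAt x) f g

/-- A family of smooth functions, defined near the points of `ℝⁿ`, is glued to a smooth function
that near each point is a combination of those members of the family that are defined there. -/
theorem exists_glue {n : ℕ} (W : (Fin n → ℝ) → Set (Fin n → ℝ)) (hW : ∀ x, IsOpen (W x))
    (hx : ∀ x, x ∈ W x) (f : (Fin n → ℝ) → SmoothFn n) :
    ∃ F : SmoothFn n, ∀ x, ∃ (J : Finset (Fin n → ℝ)) (ρ : (Fin n → ℝ) → SmoothFn n),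
      (∀ j ∈ J, x ∈ W j) ∧ F.1 =ᶠ[𝓝 x] (∑ j ∈ J, ρ j * f j : SmoothFn n).1 ∧
        (∑ j ∈ J, ρ j : SmoothFn n).1 =ᶠ[𝓝 x] fun _ => 1 := by
  obtain ⟨ρ, hρ⟩ := SmoothPartitionOfUnity.exists_isSubordinate
    (modelWithCornersSelf ℝ (Fin n → ℝ)) isClosed_univ W hW
    (fun x _ => Set.mem_iUnion.2 ⟨x, hx x⟩)
  have hsm (j) : ContDiff ℝ ∞ (ρ j) := (ρ j).contMDiff.contDiff
  have hF : ContDiff ℝ ∞ fun x => ∑ᶠ j, ρ j x • f j x := by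
    refine (ρ.contMDiff_finsum_smul (g := fun j => (f j).1) (n := ⊤) fun j x _ => ?_).contDiff
    exact (f j).contDiff.contDiffAt.contMDiffAt
  -- `fintsupport x` collects the indices whose closed support contains `x`. Subordination puts `x`
  -- in their `W j`, and near `x` no other index contributes.
  refine ⟨mk _ hF, fun x => ⟨ρ.fintsupport x, fun j => mk (ρ j) (hsm j), ?_, ?_, ?_⟩⟩
  · intro j hj
    exact hρ j ((ρ.mem_fintsupport_iff x j).1 hj)
  · filter_upwards [ρ.eventually_finsupport_subset x] with y hy
    rw [sum_apply]
    refine finsum_eq_sum_of_support_subset _ fun j hj => hy ?_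
    rw [ρ.mem_finsupport]
    intro h0
    exact hj (by simp [h0])
  · filter_upwards [ρ.eventually_finsupport_subset x] with y hy
    rw [sum_apply]
    exact ρ.sum_finsupport' y (Set.mem_univ y) hy

end SmoothFn

end SmoothFunctions

/-! ### Ideals and quotients of `C^∞`-rings. -/

namespace CInftyRing

attribute [local instance 50] toCommRing

section Basic

variable {A : Type u} [CInftyRing A] {B : Type v} [CInftyRing B]

/-- The morphism `C^∞(ℝⁿ) → A` that sends the coordinates to given elements. -/
def evalHom {n : ℕ} (a : Fin n → A) : Hom (SmoothFn n) A :=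
  ⟨fun f => op f a, fun f g => op_comp f g a⟩

/-- The homomorphism of the underlying rings. -/
abbrev Hom.ringHom (φ : Hom A B) : A →+* B := φ.toRingHom

theorem Hom.map_eq_op {n : ℕ} (φ : Hom (SmoothFn n) A) (f : SmoothFn n) :
    φ f = op f fun i => φ (SmoothFn.proj i) := φ.map_op f SmoothFn.proj

theorem Hom.mem_ker {n : ℕ} (φ : Hom (SmoothFn n) A) (f : SmoothFn n) :
    f ∈ φ.ker ↔ φ f = 0 := Iff.rfl

theorem isInv_iff {s t : A} : Loc.IsInv s t ↔ s * t = 1 := Iff.rfl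

/-- The inverse of a bijective morphism. -/
def Hom.inverse (φ : Hom A B) (h : Function.Bijective φ) : Hom B A where
  toFun := (Equiv.ofBijective φ h).symm
  map_op f b := by
    apply h.1
    rw [φ.map_op]
    refine ((Equiv.ofBijective φ h).apply_symm_apply _).trans (congrArg _ (funext fun i => ?_))
    exact ((Equiv.ofBijective φ h).apply_symm_apply _).symm

theorem Hom.apply_inverse (φ : Hom A B) (h : Function.Bijective φ) (b : B) :
    φ (φ.inverse h b) = b := (Equiv.ofBijective φ h).apply_symm_apply _

theorem Hom.inverse_apply (φ : Hom A B) (h : Function.Bijective φ) (a : A) :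
    φ.inverse h (φ a) = a := (Equiv.ofBijective φ h).symm_apply_apply _

/-- Ideals are congruences for all the operations of a `C^∞`-ring. -/
theorem op_sub_op_mem (J : Ideal A) {n : ℕ} (f : SmoothFn n) {a a' : Fin n → A}
    (h : ∀ i, a i - a' i ∈ J) : op f a - op f a' ∈ J := by
  obtain ⟨g, hg⟩ := f.hadamard
  let ε := evalHom (Fin.append a a')
  -- Hadamard's formula as an identity in `C^∞(ℝⁿ⁺ⁿ)`; evaluation at `(a, a')` carries it to `A`.
  have key : SmoothFn.comp f (fun i => SmoothFn.proj (Fin.castAdd n i)) -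
      SmoothFn.comp f (fun i => SmoothFn.proj (Fin.natAdd n i)) =
      ∑ i, (SmoothFn.proj (Fin.castAdd n i) - SmoothFn.proj (Fin.natAdd n i)) * g i := by
    refine SmoothFn.ext fun z => ?_
    have hz : Fin.append (fun i => z (Fin.castAdd n i)) (fun i => z (Fin.natAdd n i)) = z :=
      Fin.append_castAdd_natAdd
    rw [SmoothFn.sub_apply, SmoothFn.sum_apply]
    refine (hg (fun i => z (Fin.castAdd n i)) (fun i => z (Fin.natAdd n i))).trans ?_
    rw [hz]
    refine Finset.sum_congr rfl fun i _ => ?_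
    rw [SmoothFn.mul_apply, SmoothFn.sub_apply]
    rfl
  have h1 := congrArg ε.ringHom key
  simp only [map_sub, map_sum, map_mul] at h1
  have hl : ∀ i, ε.ringHom (SmoothFn.proj (Fin.castAdd n i)) = a i := fun i =>
    (op_proj _ _).trans (Fin.append_left a a' i)
  have hr : ∀ i, ε.ringHom (SmoothFn.proj (Fin.natAdd n i)) = a' i := fun i =>
    (op_proj _ _).trans (Fin.append_right a a' i)
  have hl' : ε.ringHom (SmoothFn.comp f fun i => SmoothFn.proj (Fin.castAdd n i)) = op f a :=
    (op_comp _ _ _).trans (congrArg _ (funext hl))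
  have hr' : ε.ringHom (SmoothFn.comp f fun i => SmoothFn.proj (Fin.natAdd n i)) = op f a' :=
    (op_comp _ _ _).trans (congrArg _ (funext hr))
  rw [hl', hr'] at h1
  rw [h1]
  refine J.sum_mem fun i _ => J.mul_mem_right _ ?_
  rw [hl, hr]
  exact h i

/-- The quotient of a `C^∞`-ring by an ideal. -/
def QuotIdeal (J : Ideal A) : Type u := A ⧸ J

namespace QuotIdeal

variable (J : Ideal A)

theorem mk_out (x : A ⧸ J) : Ideal.Quotient.mk J (Quotient.out x) = x := Quotient.out_eq x

theorem mk_op_out {n : ℕ} (f : SmoothFn n) (a : Fin n → A) :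
    Ideal.Quotient.mk J (op f fun i => Quotient.out (Ideal.Quotient.mk J (a i))) =
      Ideal.Quotient.mk J (op f a) := by
  rw [Ideal.Quotient.eq]
  refine op_sub_op_mem J f fun i => ?_
  rw [← Ideal.Quotient.eq]
  exact mk_out J _

instance : CInftyRing (QuotIdeal J) where
  op f x := Ideal.Quotient.mk J (op f fun i => Quotient.out (x i))
  op_proj i x := by
    rw [op_proj]
    exact mk_out J _
  op_comp f g x := by
    rw [op_comp]
    exact (mk_op_out J f _).symm

/-- The quotient morphism. -/
def mk : Hom A (QuotIdeal J) := ⟨fun a => Ideal.Quotient.mk J a, fun f a => (mk_op_out J f a).symm⟩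

theorem mk_eq_iff {a b : A} : mk J a = mk J b ↔ a - b ∈ J := Ideal.Quotient.eq

end QuotIdeal

/-! ### Localization at a point of the spectrum. -/

namespace Sp

/-- Evaluation at a point, as a homomorphism of rings. -/
def evalRingHom (p : Sp A) : A →+* ℝ where
  toFun := p.eval
  map_one' := p.eval_op _ _
  map_zero' := p.eval_op _ _
  map_add' _ _ := p.eval_op _ _
  map_mul' _ _ := p.eval_op _ _

theorem eval_mul (p : Sp A) (a b : A) : p.eval (a * b) = p.eval a * p.eval b :=
  map_mul p.evalRingHom a b

theorem eval_one (p : Sp A) : p.eval (1 : A) = 1 := map_one p.evalRingHom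

theorem ext {p q : Sp A} (h : ∀ a, p.eval a = q.eval a) : p = q := Hom.ext (funext h)

theorem basicOpen_mul (a b : A) : basicOpen (a * b) = basicOpen a ∩ basicOpen b := by
  ext p
  simp [basicOpen, eval_mul]

theorem isOpen_basicOpen (a : A) : IsOpen (basicOpen a) :=
  TopologicalSpace.isOpen_generateFrom_of_mem ⟨a, rfl⟩

theorem isTopologicalBasis_basicOpen : IsTopologicalBasis (Set.range (basicOpen (A := A))) where
  exists_subset_inter := by
    rintro _ ⟨a, rfl⟩ _ ⟨b, rfl⟩ p hp
    exact ⟨_, ⟨a * b, rfl⟩, by rwa [basicOpen_mul], (basicOpen_mul a b).subset⟩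
  sUnion_eq := Set.eq_univ_of_forall fun p =>
    ⟨basicOpen 1, ⟨1, rfl⟩, by simp [basicOpen, eval_one]⟩
  eq_generateFrom := rfl

theorem exists_basicOpen_subset {U : Set (Sp A)} (hU : IsOpen U) {p : Sp A} (hp : p ∈ U) :
    ∃ a : A, p.eval a ≠ 0 ∧ basicOpen a ⊆ U := by
  obtain ⟨_, ⟨a, rfl⟩, ha, h⟩ := isTopologicalBasis_basicOpen.exists_subset_of_mem_open hp hU
  exact ⟨a, ha, h⟩

/-- An element that does not vanish at `p` is invertible near `p`. -/
theorem exists_inv (p : Sp A) {s : A} (hs : p.eval s ≠ 0) :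
    ∃ c b : A, p.eval b ≠ 0 ∧ b * (s * c) = b := by
  let x : Fin 1 → ℝ := fun _ => p.eval s
  -- Work in the single variable `s`: `g` inverts the coordinate near the number `p(s)`, and `β`
  -- vanishes wherever it fails to. Substituting `s` gives `c = g(s)` and `b = β(s)`.
  obtain ⟨g, hg⟩ := (SmoothFn.proj (0 : Fin 1)).exists_inv (x := x) hs
  obtain ⟨β, hβ, hβ0⟩ := SmoothFn.exists_bump hg
  let ε := evalHom (fun _ : Fin 1 => s)
  refine ⟨ε g, ε β, ?_, ?_⟩
  · have : p.eval (ε β) = β x := p.eval_op β _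
    rw [this, hβ.self_of_nhds]
    exact one_ne_zero
  · have h1 : β * (SmoothFn.proj 0 * g) = β := by
      refine SmoothFn.ext fun y => ?_
      rw [SmoothFn.mul_apply, SmoothFn.mul_apply]
      by_cases hy : SmoothFn.proj 0 y * g y = 1
      · rw [hy, mul_one]
      · rw [hβ0 y hy, zero_mul]
    have h2 := congrArg ε.ringHom h1
    rw [map_mul, map_mul] at h2
    have h3 : ε.ringHom (SmoothFn.proj 0) = s := op_proj _ _
    rw [h3] at h2
    exact h2

/-- The elements of `A` that vanish near `p`. -/
def vanishingNear (p : Sp A) : Ideal A where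
  carrier := {a | ∃ b : A, p.eval b ≠ 0 ∧ b * a = 0}
  zero_mem' := ⟨1, by rw [eval_one]; exact one_ne_zero, mul_zero _⟩
  add_mem' := by
    rintro x y ⟨b, hb, hx⟩ ⟨c, hc, hy⟩
    refine ⟨b * c, by rw [eval_mul]; exact mul_ne_zero hb hc, ?_⟩
    calc b * c * (x + y) = c * (b * x) + b * (c * y) := by ring
      _ = 0 := by rw [hx, hy, mul_zero, mul_zero, add_zero]
  smul_mem' := by
    rintro c x ⟨b, hb, hx⟩
    refine ⟨b, hb, ?_⟩
    calc b * (c * x) = c * (b * x) := by ring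
      _ = 0 := by rw [hx, mul_zero]

theorem of_isUnit (p : Sp A) {b : A} (hb : p.eval b ≠ 0) :
    IsUnit (Loc.of A (nonvanishingAt p) b) :=
  IsUnit.of_mul_eq_one _ (isInv_iff.1 (Loc.isInv_of (S := nonvanishingAt p) ⟨b, hb⟩))

/-- In the quotient by `vanishingNear p`, elements that do not vanish at `p` are already invertible,
by `exists_inv`; hence `A_p` maps to that quotient, and equality in `A_p` forces equality there. -/
theorem of_eq_of_iff (p : Sp A) {c c' : A} :
    Loc.of A (nonvanishingAt p) c = Loc.of A (nonvanishingAt p) c' ↔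
      ∃ b : A, p.eval b ≠ 0 ∧ b * c = b * c' := by
  constructor
  · intro h
    let φ : Hom (LocAt p) (QuotIdeal (vanishingNear p)) :=
      Loc.lift (QuotIdeal.mk _) fun s => by
        obtain ⟨t, b, hb, hbt⟩ := p.exists_inv s.2
        refine ⟨QuotIdeal.mk _ t, isInv_iff.2 ?_⟩
        have h1 : (QuotIdeal.mk (vanishingNear p)).ringHom (s.1 * t) =
            (QuotIdeal.mk (vanishingNear p)).ringHom 1 :=
          (QuotIdeal.mk_eq_iff _).2 ⟨b, hb, by rw [mul_sub, hbt, mul_one, sub_self]⟩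
        rw [map_mul, map_one] at h1
        exact h1
    have h1 : QuotIdeal.mk (vanishingNear p) c = QuotIdeal.mk (vanishingNear p) c' :=
      congrArg φ h
    obtain ⟨b, hb, h0⟩ := (QuotIdeal.mk_eq_iff _).1 h1
    exact ⟨b, hb, sub_eq_zero.1 (by rw [← mul_sub, h0])⟩
  · rintro ⟨b, hb, h⟩
    have h1 := congrArg (Loc.of A (nonvanishingAt p)).ringHom h
    rw [map_mul, map_mul] at h1
    exact (p.of_isUnit hb).mul_left_cancel h1

/-- An element of a localization at elements that do not vanish at `p` comes, near `p`, from an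
element of the ring. -/
theorem exists_of_near {S : Set A} (p : Sp A) (hp : ∀ s ∈ S, p.eval s ≠ 0) (x : Loc A S) :
    ∃ c b : A, p.eval b ≠ 0 ∧ ∀ (q : Sp A) (hq : ∀ s ∈ S, Hom.id A s ∈ nonvanishingAt q),
      q.eval b ≠ 0 → Loc.map (Hom.id A) hq x = Loc.of A (nonvanishingAt q) c := by
  suffices ∀ x : PreLoc A S, ∃ c b : A, p.eval b ≠ 0 ∧
      ∀ (q : Sp A) (hq : ∀ s ∈ S, Hom.id A s ∈ nonvanishingAt q),
        q.eval b ≠ 0 → Loc.map (Hom.id A) hq (Loc.mk x) = Loc.of A (nonvanishingAt q) c by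
    rw [← Loc.mk_out x]
    exact this _
  intro x
  induction x with
  | of a => exact ⟨a, 1, by rw [eval_one]; exact one_ne_zero, fun q hq _ => rfl⟩
  -- The inverse of `s` is replaced by an element `c` with `b * (s * c) = b`. It inverts `s` in
  -- `A_q` for every `q` with `q(b) ≠ 0`, so uniqueness of inverses settles all these `q` at once.
  | inv s =>
    obtain ⟨c, b, hb, h⟩ := p.exists_inv (hp s.1 s.2)
    refine ⟨c, b, hb, fun q hq hqb => ?_⟩
    refine Loc.IsInv.unique ((Loc.isInv_of s).map (Loc.map (Hom.id A) hq)) (isInv_iff.2 ?_)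
    have h1 : Loc.of A (nonvanishingAt q) (s.1 * c) = Loc.of A (nonvanishingAt q) 1 :=
      q.of_eq_of_iff.2 ⟨b, hqb, by rw [h, mul_one]⟩
    have h2 := map_mul (Loc.of A (nonvanishingAt q)).ringHom s.1 c
    have h3 := map_one (Loc.of A (nonvanishingAt q)).ringHom
    exact h2.symm.trans (h1.trans h3)
  | @op n f x ih =>
    choose c b hb h using ih
    refine ⟨CInftyRing.op f c, CInftyRing.op (prodFn n) b, (eval_prod_ne_zero p b).2 hb,
      fun q hq hqb => ?_⟩
    rw [← Loc.op_mk, Hom.map_op, Hom.map_op]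
    exact congrArg _ (funext fun i => h i q hq ((eval_prod_ne_zero q b).1 hqb i))

theorem of_surjective (p : Sp A) : Function.Surjective (Loc.of A (nonvanishingAt p)) := by
  intro x
  obtain ⟨c, b, hb, h⟩ := p.exists_of_near (fun _ hs => hs) x
  exact ⟨c, ((Loc.map_id (fun _ h => h) x).symm.trans (h p (fun _ hs => hs) hb)).symm⟩

/-- Fractions are replaced by elements of `A` after the neighbourhood is shrunk; this is the form in
which sections are used from here on. -/
theorem exists_of_section {U : Opens (Sp A)} (s : Sections U) (p : U) :
    ∃ c b : A, p.1.eval b ≠ 0 ∧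
      ∀ q : U, q.1.eval b ≠ 0 → s.1 q = Loc.of A (nonvanishingAt q.1) c := by
  obtain ⟨a, ha, x, hx⟩ := s.2 p
  obtain ⟨c, b, hb, h⟩ := p.1.exists_of_near (S := nonvanishingOn a) (fun _ hs => hs p.1 ha) x
  refine ⟨c, b * a, by rw [eval_mul]; exact mul_ne_zero hb ha, fun q hq => ?_⟩
  rw [eval_mul] at hq
  exact (hx q (right_ne_zero_of_mul hq)).trans (h q.1 _ (left_ne_zero_of_mul hq))

theorem isLocallyFraction_of {U : Opens (Sp A)} (s : ∀ p : U, LocAt p.1)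
    (h : ∀ p : U, ∃ (c : A) (W : Set (Sp A)), IsOpen W ∧ p.1 ∈ W ∧
      ∀ q : U, q.1 ∈ W → s q = Loc.of A (nonvanishingAt q.1) c) : IsLocallyFraction U s := by
  intro p
  obtain ⟨c, W, hW, hp, hc⟩ := h p
  obtain ⟨b, hb, hbW⟩ := exists_basicOpen_subset hW hp
  exact ⟨b, hb, Loc.of A _ c, fun q hq => hc q (hbW hq)⟩

/-- The section given by an element of the ring. -/
def ofSection (U : Opens (Sp A)) : Hom A (Sections U) where
  toFun a := ⟨fun p => Loc.of A (nonvanishingAt p.1) a,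
    isLocallyFraction_of _ fun _ => ⟨a, Set.univ, isOpen_univ, trivial, fun _ _ => rfl⟩⟩
  map_op f a := Subtype.ext (funext fun p => (Loc.of A (nonvanishingAt p.1)).map_op f a)

theorem eval_eq_zero_of_of_eq_zero (p : Sp A) {c : A}
    (h : Loc.of A (nonvanishingAt p) c = Loc.of A (nonvanishingAt p) 0) : p.eval c = 0 := by
  obtain ⟨b, hb, h⟩ := p.of_eq_of_iff.1 h
  have h1 := congrArg p.eval h
  rw [mul_zero, eval_mul] at h1
  exact (mul_eq_zero.1 (h1.trans (map_zero p.evalRingHom))).resolve_left hb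

end Sp

end Basic

/-- Evaluation of a combination of smooth functions with coefficients of sum one. -/
theorem ringHom_combination {m : ℕ} {R : Type*} [CommRing R] (ev : SmoothFn m →+* R)
    {y : Fin m → ℝ} (hev : ∀ f g : SmoothFn m, f.1 =ᶠ[𝓝 y] g.1 → ev f = ev g)
    {ι : Type*} {J : Finset ι} {ρ g : ι → SmoothFn m} {F : SmoothFn m}
    (hF : F.1 =ᶠ[𝓝 y] (∑ j ∈ J, ρ j * g j : SmoothFn m).1)
    (hρ : (∑ j ∈ J, ρ j : SmoothFn m).1 =ᶠ[𝓝 y] fun _ => 1)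
    {r : R} (hr : ∀ j ∈ J, ev (g j) = r) : ev F = r := by
  have h1 : ev (∑ j ∈ J, ρ j) = 1 := (hev _ 1 hρ).trans (map_one ev)
  rw [hev _ _ hF, map_sum]
  rw [map_sum] at h1
  calc ∑ j ∈ J, ev (ρ j * g j) = ∑ j ∈ J, ev (ρ j) * r :=
        Finset.sum_congr rfl fun j hj => by rw [map_mul, hr j hj]
    _ = r := by rw [← Finset.sum_mul, h1, one_mul]

/-! ### The spectrum of a quotient of `C^∞(ℝⁿ)` as a closed subset of `ℝⁿ`. -/

namespace Sp

variable {A : Type u} [CInftyRing A] {n : ℕ} (π : Hom (SmoothFn n) A)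

/-- The point of `ℝⁿ` given by a point of the spectrum of a quotient of `C^∞(ℝⁿ)`. -/
def coords (p : Sp A) : Fin n → ℝ := fun i => p.eval (π (SmoothFn.proj i))

theorem eval_apply (p : Sp A) (f : SmoothFn n) : p.eval (π f) = f (coords π p) := by
  rw [π.map_eq_op, eval_op]
  rfl

/-- A bump function that vanishes where `f` and `g` differ turns the equality of germs into an
identity in `C^∞(ℝⁿ)`. -/
theorem mul_eq_of_eventuallyEq (p : Sp A) {f g : SmoothFn n} (h : f.1 =ᶠ[𝓝 (coords π p)] g.1) :
    ∃ b : A, p.eval b ≠ 0 ∧ b * π f = b * π g := by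
  obtain ⟨β, hβ, hβ0⟩ := SmoothFn.exists_bump h
  refine ⟨π β, ?_, ?_⟩
  · rw [eval_apply, hβ.self_of_nhds]
    exact one_ne_zero
  · have h1 : β * f = β * g := by
      refine SmoothFn.ext fun y => ?_
      rw [SmoothFn.mul_apply, SmoothFn.mul_apply]
      by_cases hy : f.1 y = g.1 y
      · rw [hy]
      · rw [hβ0 y hy, zero_mul, zero_mul]
    have h2 := congrArg π.ringHom h1
    rw [map_mul, map_mul] at h2
    exact h2

theorem of_eq_of_eventuallyEq (p : Sp A) {f g : SmoothFn n}
    (h : f.1 =ᶠ[𝓝 (coords π p)] g.1) :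
    Loc.of A (nonvanishingAt p) (π f) = Loc.of A (nonvanishingAt p) (π g) :=
  p.of_eq_of_iff.2 (mul_eq_of_eventuallyEq π p h)

/-- An open `W` is the nonvanishing locus of some smooth `φ`, so its preimage is the single basic
open set of `π φ`. -/
theorem continuous_coords : Continuous (coords π) := by
  refine continuous_def.2 fun W hW => ?_
  obtain ⟨φ, hφ⟩ := SmoothFn.exists_support hW
  have : coords π ⁻¹' W = basicOpen (π φ) := by
    ext p
    rw [Set.mem_preimage, ← hφ, ← eval_apply]
    rfl
  rw [this]
  exact isOpen_basicOpen _

variable {π} (hπ : Function.Surjective π)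

include hπ in
theorem coords_injective : Function.Injective (coords π) := fun p q h => by
  refine Sp.ext fun a => ?_
  obtain ⟨f, rfl⟩ := hπ a
  rw [eval_apply, eval_apply, h]

include hπ in
-- Evaluation at a common zero of the kernel does not depend on the chosen lifts, so it descends to
-- `A`.
theorem exists_coords_eq {y : Fin n → ℝ} (hy : ∀ f ∈ π.ker, f y = 0) :
    ∃ p : Sp A, coords π p = y := by
  have key {f g : SmoothFn n} (h : π f = π g) : f y = g y := by
    have : f - g ∈ π.ker := (π.mem_ker _).2
      ((map_sub π.ringHom f g).trans (sub_eq_zero.2 h))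
    have := hy _ this
    rw [SmoothFn.sub_apply] at this
    exact sub_eq_zero.1 this
  choose l hl using hπ
  let p : Sp A := ⟨fun a => l a y, fun {m} f a => by
    have : l (op f a) y = (SmoothFn.comp f fun i => l (a i)) y := by
      refine key ((hl _).trans ?_)
      refine Eq.trans ?_ (π.map_op f fun i => l (a i)).symm
      exact congrArg _ (funext fun i => (hl _).symm)
    exact this⟩
  exact ⟨p, funext fun i => key (hl _)⟩

include hπ in
theorem isClosedEmbedding_coords : Topology.IsClosedEmbedding (coords π) where
  eq_induced := by
    refine le_antisymm (continuous_iff_le_induced.1 (continuous_coords π)) ?_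
    refine le_generateFrom ?_
    rintro _ ⟨a, rfl⟩
    obtain ⟨f, rfl⟩ := hπ a
    refine isOpen_induced_iff.2 ⟨{y | f y ≠ 0}, isOpen_ne.preimage f.continuous, ?_⟩
    ext p
    change f (coords π p) ≠ 0 ↔ p.eval (π f) ≠ 0
    rw [eval_apply]
  injective := coords_injective hπ
  isClosed_range := by
    have : Set.range (coords π) = ⋂ f ∈ π.ker, {y | f y = 0} := by
      ext y
      simp only [Set.mem_iInter]
      constructor
      · rintro ⟨p, rfl⟩ f hf
        change f (coords π p) = 0
        rw [← eval_apply, (π.mem_ker f).1 hf]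
        exact map_zero p.evalRingHom
      · exact fun h => exists_coords_eq hπ h
    rw [this]
    exact isClosed_biInter fun f _ => isClosed_eq f.continuous continuous_const

include hπ in
/-- Sections over a closed subset of the spectrum extend. -/
theorem exists_of_eq_of_isClosed {Z : Set (Sp A)} (hZ : IsClosed Z) (s : ∀ z : Z, LocAt z.1)
    (hs : ∀ z : Z, ∃ c b : A, z.1.eval b ≠ 0 ∧
      ∀ w : Z, w.1.eval b ≠ 0 → s w = Loc.of A (nonvanishingAt w.1) c) :
    ∃ a : A, ∀ z : Z, s z = Loc.of A (nonvanishingAt z.1) a := by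
  classical
  have hs' : ∀ z : Z, ∃ f β : SmoothFn n, β (coords π z.1) ≠ 0 ∧
      ∀ w : Z, β (coords π w.1) ≠ 0 → s w = Loc.of A (nonvanishingAt w.1) (π f) := by
    intro z
    obtain ⟨c, b, hb, h⟩ := hs z
    obtain ⟨f, rfl⟩ := hπ c
    obtain ⟨β, rfl⟩ := hπ b
    simp only [eval_apply] at hb h
    exact ⟨f, β, hb, h⟩
  choose f β hβ h using hs'
  have hT : IsClosed (coords π '' Z) := (isClosedEmbedding_coords hπ).isClosedMap _ hZ
  -- Extend the local data to a cover of all of `ℝⁿ`: off the closed image of `Z` the condition is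
  -- void and `0` serves.
  have hex : ∀ y : Fin n → ℝ, ∃ (W : Set (Fin n → ℝ)) (g : SmoothFn n), IsOpen W ∧ y ∈ W ∧
      ∀ w : Z, coords π w.1 ∈ W → s w = Loc.of A (nonvanishingAt w.1) (π g) := by
    intro y
    by_cases hy : y ∈ coords π '' Z
    · obtain ⟨z, hz, rfl⟩ := hy
      exact ⟨{y | β ⟨z, hz⟩ y ≠ 0}, f ⟨z, hz⟩, isOpen_ne.preimage (β _).continuous, hβ ⟨z, hz⟩,
        fun w hw => h ⟨z, hz⟩ w hw⟩
    · exact ⟨(coords π '' Z)ᶜ, 0, hT.isOpen_compl, hy,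
        fun w hw => absurd ⟨w.1, w.2, rfl⟩ hw⟩
  choose W g hW hyW hg using hex
  obtain ⟨F, hF⟩ := SmoothFn.exists_glue W hW hyW g
  refine ⟨π F, fun z => ?_⟩
  obtain ⟨J, ρ, hJ, h1, h2⟩ := hF (coords π z.1)
  -- At `z` all the functions that contribute have the same class `s z`, and their coefficients sum
  -- to `1`.
  exact (ringHom_combination ((Loc.of A (nonvanishingAt z.1)).ringHom.comp π.ringHom)
    (fun _ _ h => of_eq_of_eventuallyEq π z.1 h) h1 h2
    fun j hj => (hg j z (hJ j hj)).symm).symm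

include hπ in
theorem ofSection_top_surjective : Function.Surjective (ofSection (A := A) ⊤) := by
  intro s
  obtain ⟨a, ha⟩ := exists_of_eq_of_isClosed hπ isClosed_univ (fun z => s.1 ⟨z.1, trivial⟩)
    fun z => by
      obtain ⟨c, b, hb, h⟩ := exists_of_section s ⟨z.1, trivial⟩
      exact ⟨c, b, hb, fun w hw => h ⟨w.1, trivial⟩ hw⟩
  exact ⟨a, Subtype.ext (funext fun p => (ha ⟨p.1, trivial⟩).symm)⟩

include hπ in
/-- If `A` is germ determined, then `A` embeds into the product of its localizations. -/
theorem eq_of_of_eq_of (hd : IsGermDeterminedIdeal π.ker) {a a' : A}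
    (h : ∀ p : Sp A, Loc.of A (nonvanishingAt p) a = Loc.of A (nonvanishingAt p) a') :
    a = a' := by
  obtain ⟨f, rfl⟩ := hπ a
  obtain ⟨f', rfl⟩ := hπ a'
  suffices f - f' ∈ π.ker from
    sub_eq_zero.1 ((map_sub π.ringHom f f').symm.trans ((π.mem_ker _).1 this))
  by_contra hf
  obtain ⟨y, hy⟩ := hd _ hf
  -- Some `β` with `β y ≠ 0` moves `f - f'` into the kernel: if `y` is a point of the spectrum,
  -- equality in `A_p` provides it; otherwise a kernel element nonzero at `y` does. Dividing by `β`
  -- near `y` contradicts the choice of `y`.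
  have main : ∃ k ∈ π.ker, ∃ β : SmoothFn n, β y ≠ 0 ∧ β * (f - f') = k := by
    by_cases hp : ∀ k ∈ π.ker, k y = 0
    · obtain ⟨p, rfl⟩ := exists_coords_eq hπ hp
      obtain ⟨b, hb, h0⟩ := p.of_eq_of_iff.1 (h p)
      obtain ⟨β, rfl⟩ := hπ b
      refine ⟨β * (f - f'), (π.mem_ker _).2 ?_, β, by rwa [eval_apply] at hb, rfl⟩
      have h1 : π.ringHom (β * (f - f')) = 0 := by
        rw [map_mul, map_sub, mul_sub]
        exact sub_eq_zero.2 h0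
      exact h1
    · push Not at hp
      obtain ⟨k, hk, hky⟩ := hp
      exact ⟨_, π.ker.mul_mem_right (f - f') hk, k, hky, rfl⟩
  obtain ⟨k, hk, β, hβ, hk'⟩ := main
  obtain ⟨g, hg⟩ := β.exists_inv hβ
  refine hy ⟨g * k, π.ker.mul_mem_left g hk, ?_⟩
  filter_upwards [hg] with z hz
  have h1 : (g * k) z = (f - f') z := by
    rw [← hk', SmoothFn.mul_apply, SmoothFn.mul_apply, ← mul_assoc, mul_comm (g z), hz, one_mul]
  exact h1.symm

include hπ in
theorem ofSection_top_bijective (hd : IsGermDeterminedIdeal π.ker) :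
    Function.Bijective (ofSection (A := A) ⊤) := by
  refine ⟨fun a a' h => eq_of_of_eq_of hπ hd fun p => ?_, ofSection_top_surjective hπ⟩
  exact congrFun (congrArg Subtype.val h) ⟨p, trivial⟩

include hπ in
/-- The sections over an open subset form a finitely generated `C^∞`-ring. -/
theorem isFinitelyGenerated_sections (U : Opens (Sp A)) : IsFinitelyGenerated (Sections U) := by
  classical
  have hcl := isClosedEmbedding_coords hπ
  obtain ⟨W₀, hW₀, hU⟩ := hcl.isInducing.isOpen_iff.1 U.2
  obtain ⟨φ, hφ⟩ := SmoothFn.exists_support hW₀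
  have hUφ : ∀ q : Sp A, q ∈ U ↔ φ (coords π q) ≠ 0 := fun q => by
    rw [hφ]
    exact (Set.ext_iff.1 hU q).symm
  have hψ : ∀ q : U, ∃ ψ : SmoothFn n, ∀ᶠ y in 𝓝 (coords π q.1), φ y * ψ y = 1 :=
    fun q => φ.exists_inv ((hUφ q.1).1 q.2)
  choose ψ hψ using hψ
  -- The section `1/φ` over `U`: local inverses of `φ` agree near points where both are defined.
  let inv : Sections U := ⟨fun q => Loc.of A (nonvanishingAt q.1) (π (ψ q)), by
    refine isLocallyFraction_of _ fun q => ?_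
    obtain ⟨V, hV, hVo, hqV⟩ := mem_nhds_iff.1 (hψ q)
    refine ⟨π (ψ q), coords π ⁻¹' V, hVo.preimage (continuous_coords π), hqV, fun r hr => ?_⟩
    refine of_eq_of_eventuallyEq π r.1 ?_
    filter_upwards [hψ r, hVo.mem_nhds hr] with y h1 hy
    have h2 : φ y * ψ q y = 1 := hV hy
    exact mul_left_cancel₀ (left_ne_zero_of_mul_eq_one h1) (h1.trans h2.symm)⟩
  let gen : Fin (n + 1) → Sections U :=
    Fin.snoc (α := fun _ => Sections U) (fun i => ofSection U (π (SmoothFn.proj i))) inv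
  let σ (q : U) : Fin (n + 1) → SmoothFn n :=
    Fin.snoc (α := fun _ => SmoothFn n) SmoothFn.proj (ψ q)
  have hgen (q : U) (i) : (gen i).1 q = Loc.of A (nonvanishingAt q.1) (π (σ q i)) := by
    refine Fin.lastCases ?_ (fun j => ?_) i
    · simp [gen, σ, inv]
    · simp only [gen, σ, Fin.snoc_castSucc]
      rfl
  -- `ev q F` is the class at `q` of `x ↦ F (x, ψ q x)`. It depends only on the germ of `F` at `pt q
  -- = (x, 1/φ(x))`.
  let ev (q : U) : Hom (SmoothFn (n + 1)) (LocAt q.1) :=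
    ((evalHom (σ q)).comp π).comp (Loc.of A (nonvanishingAt q.1))
  have hev (q : U) (F : SmoothFn (n + 1)) : (op F gen).1 q = ev q F := by
    refine Eq.trans ?_ ((congrArg (Loc.of A (nonvanishingAt q.1)) (π.map_op F (σ q))).trans
      ((Loc.of A (nonvanishingAt q.1)).map_op F _)).symm
    exact congrArg (op F) (funext (hgen q))
  let pt (q : U) : Fin (n + 1) → ℝ := fun i => σ q i (coords π q.1)
  have hpt0 (q : U) (i : Fin n) : pt q i.castSucc = coords π q.1 i := by
    simp [pt, σ, SmoothFn.proj]
  have hpt1 (q : U) : φ (coords π q.1) * pt q (Fin.last n) = 1 := by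
    simpa [pt, σ] using (hψ q).self_of_nhds
  have hevpt (q : U) {f g : SmoothFn (n + 1)} (h : f.1 =ᶠ[𝓝 (pt q)] g.1) : ev q f = ev q g := by
    refine of_eq_of_eventuallyEq π q.1 ?_
    have hc : Continuous fun y => fun i => σ q i y :=
      continuous_pi fun i => (σ q i).continuous
    exact hc.continuousAt.eventually h
  let init (y : Fin (n + 1) → ℝ) : Fin n → ℝ := fun i => y i.castSucc
  have hinit : Continuous init := by fun_prop
  have hinitpt (q : U) : init (pt q) = coords π q.1 := funext (hpt0 q)
  -- The equation `φ(x) t = 1` excludes the boundary of `U`, so the graph of `1/φ` is closed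
  -- although `U` need not be.
  have hT : IsClosed (Set.range pt) := by
    have : Set.range pt = init ⁻¹' (Set.range (coords π)) ∩
        {y | φ (init y) * y (Fin.last n) = 1} := by
      ext y
      constructor
      · rintro ⟨q, rfl⟩
        refine ⟨⟨q.1, (hinitpt q).symm⟩, ?_⟩
        change φ (init (pt q)) * _ = 1
        rw [hinitpt, hpt1]
      · rintro ⟨⟨q, hq⟩, hy⟩
        have hy : φ (init y) * y (Fin.last n) = 1 := hy
        rw [← hq] at hy
        have hqU : q ∈ U := (hUφ q).2 (left_ne_zero_of_mul_eq_one hy)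
        refine ⟨⟨q, hqU⟩, funext fun i => ?_⟩
        refine Fin.lastCases ?_ (fun j => ?_) i
        · exact mul_left_cancel₀ (left_ne_zero_of_mul_eq_one hy) ((hpt1 ⟨q, hqU⟩).trans hy.symm)
        · rw [hpt0]
          exact congrFun hq j
    rw [this]
    exact (hcl.isClosed_range.preimage hinit).inter
      (isClosed_eq ((φ.continuous.comp hinit).mul (continuous_apply _)) continuous_const)
  refine ⟨n + 1, evalHom gen, fun s => ?_⟩
  have hs : ∀ q : U, ∃ f β : SmoothFn n, β (coords π q.1) ≠ 0 ∧
      ∀ r : U, β (coords π r.1) ≠ 0 → s.1 r = Loc.of A (nonvanishingAt r.1) (π f) := by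
    intro q
    obtain ⟨c, b, hb, h⟩ := exists_of_section s q
    obtain ⟨f, rfl⟩ := hπ c
    obtain ⟨β, rfl⟩ := hπ b
    simp only [eval_apply] at hb h
    exact ⟨f, β, hb, h⟩
  choose f β hβ hfs using hs
  let lift (f : SmoothFn n) : SmoothFn (n + 1) :=
    SmoothFn.comp f fun i => SmoothFn.proj i.castSucc
  have hlift (q : U) (f : SmoothFn n) : ev q (lift f) = Loc.of A (nonvanishingAt q.1) (π f) := by
    have : SmoothFn.comp (lift f) (σ q) = f := by
      refine SmoothFn.ext fun y => ?_
      change f (fun i => σ q i.castSucc y) = f y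
      simp [σ, SmoothFn.proj]
    exact congrArg (fun g => Loc.of A (nonvanishingAt q.1) (π g)) this
  have hex : ∀ y : Fin (n + 1) → ℝ, ∃ (W : Set (Fin (n + 1) → ℝ)) (g : SmoothFn (n + 1)),
      IsOpen W ∧ y ∈ W ∧ ∀ r : U, pt r ∈ W → s.1 r = ev r g := by
    intro y
    by_cases hy : y ∈ Set.range pt
    · obtain ⟨q, rfl⟩ := hy
      refine ⟨{y | β q (init y) ≠ 0}, lift (f q),
        isOpen_ne.preimage ((β q).continuous.comp hinit), ?_, fun r hr => ?_⟩
      · change β q (init (pt q)) ≠ 0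
        rw [hinitpt]
        exact hβ q
      · rw [hlift]
        refine hfs q r ?_
        have hr : β q (init (pt r)) ≠ 0 := hr
        rwa [hinitpt] at hr
    · exact ⟨(Set.range pt)ᶜ, 0, hT.isOpen_compl, hy, fun r hr => absurd ⟨r, rfl⟩ hr⟩
  choose W g hW hyW hg using hex
  obtain ⟨F, hF⟩ := SmoothFn.exists_glue W hW hyW g
  refine ⟨F, Subtype.ext (funext fun q => (hev q F).trans ?_)⟩
  obtain ⟨J, ρ, hJ, h1, h2⟩ := hF (pt q)
  exact ringHom_combination (ev q).ringHom (fun _ _ h => hevpt q h) h1 h2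
    fun j hj => (hg j q (hJ j hj)).symm

end Sp

end CInftyRing

namespace CInftySpace

open AlgebraicGeometry CInftyRing

attribute [local instance 50] toCommRing

/-! ### Germs and gluing of sections. -/

section Germ

variable (X : PresheafedSpace.{u} CInftyRingCat.{u})

/-- The ring underlying the stalk. -/
abbrev Stalk (x : X.carrier) : Type u := (ringPresheaf X).stalk x

/-- The sections over an open set. -/
abbrev Sec (U : Opens X.carrier) : Type u := X.presheaf.obj (op U)

/-- The germ of a section, as a homomorphism of rings. -/
def germ (U : Opens X.carrier) (x : X.carrier) (hx : x ∈ U) : Sec X U →+* Stalk X x :=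
  ((ringPresheaf X).germ U x hx).hom

/-- Restriction of sections. -/
def restr {U V : Opens X.carrier} (h : V ≤ U) : Hom (Sec X U) (Sec X V) :=
  X.presheaf.map (homOfLE h).op

variable {X}

theorem germ_map {U V : Opens X.carrier} (i : op U ⟶ op V) (x : X.carrier) (hx : x ∈ V)
    (s : Sec X U) :
    germ X V x hx (Hom.toFun (X.presheaf.map i) s) = germ X U x (i.unop.le hx) s :=
  (ringPresheaf X).germ_res_apply' i x hx s

theorem germ_restr {U V : Opens X.carrier} (h : V ≤ U) (x : X.carrier) (hx : x ∈ V)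
    (s : Sec X U) : germ X V x hx (restr X h s) = germ X U x (h hx) s :=
  germ_map _ x hx s

theorem germ_eq_germ_iff {U V : Opens X.carrier} {x : X.carrier} (hU : x ∈ U) (hV : x ∈ V)
    {s : Sec X U} {t : Sec X V} : germ X U x hU s = germ X V x hV t ↔
      ∃ (W : Opens X.carrier) (hWU : W ≤ U) (hWV : W ≤ V), x ∈ W ∧
        restr X hWU s = restr X hWV t := by
  constructor
  · intro h
    obtain ⟨W, hW, i, j, e⟩ := (ringPresheaf X).germ_eq x hU hV s t h
    exact ⟨W, i.le, j.le, hW, e⟩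
  · rintro ⟨W, hWU, hWV, hW, e⟩
    rw [← germ_restr hWU x hW, ← germ_restr hWV x hW, e]

theorem exists_germ_eq {x : X.carrier} (t : Stalk X x) :
    ∃ (U : Opens X.carrier) (hU : x ∈ U) (s : Sec X U), germ X U x hU s = t :=
  (ringPresheaf X).exists_germ_eq t

theorem eventually_germ_eq {U V : Opens X.carrier} {x : X.carrier} {hU : x ∈ U} {hV : x ∈ V}
    {s : Sec X U} {t : Sec X V} (h : germ X U x hU s = germ X V x hV t) :
    ∃ (W : Opens X.carrier), x ∈ W ∧ ∀ y ∈ W, ∀ (hyU : y ∈ U) (hyV : y ∈ V),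
      germ X U y hyU s = germ X V y hyV t := by
  obtain ⟨W, hWU, hWV, hW, e⟩ := (germ_eq_germ_iff hU hV).1 h
  exact ⟨W, hW, fun y hy _ _ => (germ_eq_germ_iff _ _).2 ⟨W, hWU, hWV, hy, e⟩⟩

/-- The stalks used are stalks of rings, so compatibility with smooth operations is stated on
representatives; finitely many equalities of germs hold on a common neighbourhood. -/
theorem germ_op_congr {n : ℕ} (f : SmoothFn n) {U V : Opens X.carrier} {x : X.carrier}
    {hU : x ∈ U} {hV : x ∈ V} {s : Fin n → Sec X U} {t : Fin n → Sec X V}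
    (h : ∀ i, germ X U x hU (s i) = germ X V x hV (t i)) :
    germ X U x hU (CInftyRing.op f s) = germ X V x hV (CInftyRing.op f t) := by
  choose W hWU hWV hW e using fun i => (germ_eq_germ_iff hU hV).1 (h i)
  let W' : Opens X.carrier := ⟨(U : Set X.carrier) ∩ V ∩ ⋂ i, W i,
    (U.2.inter V.2).inter (isOpen_iInter_of_finite fun i => (W i).2)⟩
  have h1 : W' ≤ U := fun y hy => hy.1.1
  have h2 : W' ≤ V := fun y hy => hy.1.2
  have h3 (i) : W' ≤ W i := fun y hy => Set.mem_iInter.1 hy.2 i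
  refine (germ_eq_germ_iff _ _).2 ⟨W', h1, h2, ⟨⟨hU, hV⟩, Set.mem_iInter.2 hW⟩, ?_⟩
  rw [(restr X h1).map_op, (restr X h2).map_op]
  refine congrArg _ (funext fun i => ?_)
  have e1 := congrArg (restr X (h3 i)) (e i)
  have comp {W₁ W₂ W₃ : Opens X.carrier} (h : W₂ ≤ W₁) (h' : W₃ ≤ W₂) (r : Sec X W₁) :
      restr X h' (restr X h r) = restr X (h'.trans h) r :=
    congrArg (fun φ : X.presheaf.obj (op W₁) ⟶ X.presheaf.obj (op W₃) => Hom.toFun φ r)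
      (X.presheaf.map_comp (homOfLE h).op (homOfLE h').op).symm
  rwa [comp, comp] at e1

/-- The map on sections induced by a morphism. -/
def appHom {Y : PresheafedSpace.{u} CInftyRingCat.{u}} (f : X ⟶ Y) (U : Opens Y.carrier) :
    Hom (Sec Y U) (Sec X ((Opens.map f.base).obj U)) := f.c.app (op U)

theorem germ_appHom_congr {Y : PresheafedSpace.{u} CInftyRingCat.{u}} (f : X ⟶ Y)
    {U V : Opens Y.carrier} {x : X.carrier} {hU : f.base x ∈ U} {hV : f.base x ∈ V}
    {s : Sec Y U} {t : Sec Y V} (h : germ Y U (f.base x) hU s = germ Y V (f.base x) hV t) :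
    germ X _ x hU (appHom f U s) = germ X _ x hV (appHom f V t) := by
  obtain ⟨W, hWU, hWV, hW, e⟩ := (germ_eq_germ_iff _ _).1 h
  refine (germ_eq_germ_iff _ _).2 ⟨(Opens.map f.base).obj W, fun _ h => hWU h,
    fun _ h => hWV h, hW, ?_⟩
  have nat {U : Opens Y.carrier} (hWU : W ≤ U) (r : Sec Y U) :
      appHom f W (restr Y hWU r) = restr X (U := (Opens.map f.base).obj U)
        (V := (Opens.map f.base).obj W) (fun _ h => hWU h) (appHom f U r) :=
    congrArg (fun φ : Y.presheaf.obj (op U) ⟶ X.presheaf.obj (op ((Opens.map f.base).obj W)) =>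
      Hom.toFun φ r) (f.c.naturality (homOfLE hWU).op)
  rw [← nat, ← nat, e]

theorem sec_ext (hX : (ringPresheaf X).IsSheaf) {U : Opens X.carrier} {s t : Sec X U}
    (h : ∀ (x : X.carrier) (hx : x ∈ U), germ X U x hx s = germ X U x hx t) : s = t :=
  TopCat.Presheaf.section_ext (⟨ringPresheaf X, hX⟩ : TopCat.Sheaf CommRingCat X.carrier) U s t h

/-- A family of germs that is locally given by sections is given by a section. -/
theorem exists_sec (hX : (ringPresheaf X).IsSheaf) (U : Opens X.carrier)
    (g : ∀ x : U, Stalk X x.1)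
    (hg : ∀ x : U, ∃ (W : Opens X.carrier) (V : Opens X.carrier) (t : Sec X V), x.1 ∈ W ∧ W ≤ V ∧
      ∀ (y : U), y.1 ∈ W → ∀ (hyV : y.1 ∈ V), g y = germ X V y.1 hyV t) :
    ∃ s : Sec X U, ∀ x : U, germ X U x.1 x.2 s = g x := by
  choose W V t hxW hWV ht using hg
  let N (x : U) : Opens X.carrier := W x ⊓ U
  have hNV (x : U) : N x ≤ V x := inf_le_left.trans (hWV x)
  have hg' (x : U) (y : X.carrier) (hy : y ∈ N x) :
      germ X (N x) y hy (restr X (hNV x) (t x)) = g ⟨y, hy.2⟩ := by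
    rw [germ_restr]
    exact (ht x ⟨y, hy.2⟩ hy.1 _).symm
  let F : TopCat.Sheaf CommRingCat X.carrier := ⟨ringPresheaf X, hX⟩
  obtain ⟨s, hs, -⟩ := F.existsUnique_gluing' N U (fun x => homOfLE inf_le_right)
    (fun x hx => Opens.mem_iSup.2 ⟨⟨x, hx⟩, hxW ⟨x, hx⟩, hx⟩)
    (fun x => restr X (hNV x) (t x)) fun x y => by
      refine sec_ext hX fun z hz => ?_
      refine (germ_map (Opens.infLELeft (N x) (N y)).op z hz _).trans ?_
      refine Eq.trans ?_ (germ_map (Opens.infLERight (N x) (N y)).op z hz _).symm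
      rw [hg', hg']
  refine ⟨s, fun x => ?_⟩
  have hx : x.1 ∈ N x := ⟨hxW x, x.2⟩
  refine (germ_restr (U := U) (V := N x) inf_le_right x.1 hx s).symm.trans ?_
  refine (congrArg (germ X (N x) x.1 hx) (hs x)).trans ?_
  exact hg' x x.1 hx

end Germ

/-- A criterion for a ring to be local with residue field `ℝ`. -/
theorem isLocalWithResidueFieldReal_of {A R : Type u} [CommRing A] [CommRing R] (γ : A →+* R)
    (hγ : Function.Surjective γ) (e : A →+* ℝ) (he : Function.Surjective e)
    (hker : ∀ a, γ a = 0 → e a = 0) (hu : ∀ a, e a ≠ 0 → IsUnit (γ a)) :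
    IsLocalWithResidueFieldReal R := by
  -- The factorization of `e` through `γ` is a local homomorphism onto a field, which makes `R`
  -- local with maximal ideal its kernel.
  let e' : R →+* ℝ := γ.liftOfSurjective hγ ⟨e, fun a ha => hker a ha⟩
  have he' (a) : e' (γ a) = e a := γ.liftOfRightInverse_comp_apply _ _ ⟨e, fun a ha => hker a ha⟩ a
  have hs : Function.Surjective e' := fun r => by
    obtain ⟨a, rfl⟩ := he r
    exact ⟨γ a, he' a⟩
  have : IsLocalHom e' := ⟨fun r hr => by
    obtain ⟨a, rfl⟩ := hγ r
    exact hu a (by rw [← he']; exact hr.ne_zero)⟩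
  have hR : IsLocalRing R := RingHom.domain_isLocalRing e'
  refine ⟨hR, ⟨?_⟩⟩
  have hk : RingHom.ker e' = IsLocalRing.maximalIdeal R :=
    IsLocalRing.eq_maximalIdeal (RingHom.ker_isMaximal_of_surjective e' hs)
  exact (Ideal.quotEquivOfEq hk.symm).trans (RingHom.quotientKerEquivOfSurjective hs)

/-! ### The spectrum is a `C^∞`-space. -/

section Spectrum

variable (A : CInftyRingCat.{u})

/-- Sections are functions subject to a local condition, so they glue pointwise. -/
theorem isSheaf_spObj : (ringPresheaf (SpObj A)).IsSheaf := by
  refine (TopCat.Presheaf.isSheaf_iff_isSheafUniqueGluing _).2 fun ι U sf hsf => ?_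
  have hsf' (i j : ι) (p : Sp A) (hi : p ∈ U i) (hj : p ∈ U j) :
      (show Sp.Sections (U i) from sf i).1 ⟨p, hi⟩ =
        (show Sp.Sections (U j) from sf j).1 ⟨p, hj⟩ :=
    congrFun (congrArg Subtype.val (show (show Sp.Sections (U i ⊓ U j) from
      (ringPresheaf (SpObj A)).map (Opens.infLELeft (U i) (U j)).op (sf i)) =
        (ringPresheaf (SpObj A)).map (Opens.infLERight (U i) (U j)).op (sf j) from hsf i j))
      ⟨p, hi, hj⟩
  have hmem (p : (iSup U : Opens (Sp A))) : ∃ i, p.1 ∈ U i := Opens.mem_iSup.1 p.2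
  choose k hk using hmem
  let s : Sp.Sections (A := A) (iSup U) := ⟨fun p => (sf (k p)).1 ⟨p.1, hk p⟩, by
    refine Sp.isLocallyFraction_of _ fun p => ?_
    obtain ⟨c, b, hb, h⟩ := Sp.exists_of_section (show Sp.Sections (U (k p)) from sf (k p))
      ⟨p.1, hk p⟩
    refine ⟨c, (show Set (Sp A) from (U (k p)).1) ∩ Sp.basicOpen b, (U (k p)).2.inter (Sp.isOpen_basicOpen b),
      ⟨hk p, hb⟩, fun q hq => ?_⟩
    exact (hsf' _ _ q.1 (hk q) hq.1).trans (h ⟨q.1, hq.1⟩ hq.2)⟩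
  refine ⟨s, fun i => ?_, fun t ht => ?_⟩
  · refine Subtype.ext (funext fun p => ?_)
    exact hsf' _ _ p.1 _ p.2
  · refine Subtype.ext (funext fun p => ?_)
    have h := ht (k p)
    exact congrFun (congrArg Subtype.val (show (show Sp.Sections (U (k p)) from
      (ringPresheaf (SpObj A)).map (Opens.leSupr U (k p)).op t) = sf (k p) from h)) ⟨p.1, hk p⟩

variable {A}

/-- Identifies the stalk with `A_p`: an equality there is witnessed by some `d` with `p(d) ≠ 0`, and
the same `d` witnesses it at every point of `U_d`. -/
theorem germ_spObj_iff {U V : Opens (Sp A)} {p : Sp A} (hU : p ∈ U) (hV : p ∈ V)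
    (s : Sp.Sections U) (t : Sp.Sections V) :
    germ (SpObj A) U p hU s = germ (SpObj A) V p hV t ↔ s.1 ⟨p, hU⟩ = t.1 ⟨p, hV⟩ := by
  refine (germ_eq_germ_iff (X := SpObj A) hU hV).trans ?_
  constructor
  · rintro ⟨W, hWU, hWV, hW, e⟩
    exact congrFun (congrArg Subtype.val (show Sp.res hWU s = Sp.res hWV t from e)) ⟨p, hW⟩
  · intro h
    obtain ⟨c, b, hb, hc⟩ := Sp.exists_of_section s ⟨p, hU⟩
    obtain ⟨c', b', hb', hc'⟩ := Sp.exists_of_section t ⟨p, hV⟩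
    rw [hc _ hb, hc' _ hb'] at h
    obtain ⟨d, hd, h⟩ := p.of_eq_of_iff.1 h
    let W : Opens (Sp A) := ⟨(U : Set (Sp A)) ∩ V ∩ (Sp.basicOpen b ∩ Sp.basicOpen b' ∩
      Sp.basicOpen d), (U.2.inter V.2).inter (((Sp.isOpen_basicOpen b).inter
        (Sp.isOpen_basicOpen b')).inter (Sp.isOpen_basicOpen d))⟩
    refine ⟨W, fun q hq => hq.1.1, fun q hq => hq.1.2, ⟨⟨hU, hV⟩, ⟨hb, hb'⟩, hd⟩,
      Subtype.ext (funext fun q => ?_)⟩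
    refine (hc ⟨q.1, q.2.1.1⟩ q.2.2.1.1).trans (Eq.trans ?_ (hc' ⟨q.1, q.2.1.2⟩ q.2.2.1.2).symm)
    exact q.1.of_eq_of_iff.2 ⟨d, q.2.2.2, h⟩

theorem germ_ofSection_iff {p : Sp A} {a a' : A} :
    germ (SpObj A) ⊤ p trivial (Sp.ofSection ⊤ a) =
      germ (SpObj A) ⊤ p trivial (Sp.ofSection ⊤ a') ↔
    Loc.of A (Sp.nonvanishingAt p) a = Loc.of A (Sp.nonvanishingAt p) a' :=
  germ_spObj_iff _ _ _ _

theorem exists_germ_ofSection {p : Sp A} (t : Stalk (SpObj A) p) :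
    ∃ a : A, germ (SpObj A) ⊤ p trivial (Sp.ofSection ⊤ a) = t := by
  obtain ⟨U, hU, s, rfl⟩ := exists_germ_eq t
  obtain ⟨a, ha⟩ := Sp.of_surjective p ((show Sp.Sections U from s).1 ⟨p, hU⟩)
  exact ⟨a, (germ_spObj_iff _ _ _ _).2 ha⟩

theorem isLocal_spObj (p : Sp A) : IsLocalWithResidueFieldReal (Stalk (SpObj A) p) := by
  let γ : A →+* Stalk (SpObj A) p :=
    (germ (SpObj A) ⊤ p trivial).comp (Sp.ofSection (A := A) ⊤).ringHom
  refine isLocalWithResidueFieldReal_of γ exists_germ_ofSection p.evalRingHom ?_ ?_ ?_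
  · intro r
    refine ⟨CInftyRing.op (SmoothFn.const 0 r) ![], ?_⟩
    exact p.eval_op _ _
  · intro a ha
    refine p.eval_eq_zero_of_of_eq_zero ?_
    exact germ_ofSection_iff.1 (ha.trans (map_zero γ).symm)
  · intro a ha
    obtain ⟨c, b, hb, h⟩ := p.exists_inv ha
    have h1 : γ (a * c) = γ 1 :=
      germ_ofSection_iff.2 (p.of_eq_of_iff.2 ⟨b, hb, by rw [h, mul_one]⟩)
    rw [map_mul, map_one] at h1
    exact IsUnit.of_mul_eq_one _ h1

theorem isSoft_spObj (hA : IsFinitelyGenerated A) : IsSoft (ringPresheaf (SpObj A)) := by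
  obtain ⟨n, π, hπ⟩ := hA
  intro Z hZ s hs
  choose a ha using fun z : Z => exists_germ_ofSection (s z)
  obtain ⟨c, hc⟩ := Sp.exists_of_eq_of_isClosed hπ hZ
    (fun z => Loc.of A (Sp.nonvanishingAt z.1) (a z)) fun z => by
      obtain ⟨U, hU, t, ht⟩ := hs z
      obtain ⟨c, b, hb, h⟩ := Sp.exists_of_section (show Sp.Sections U from t) ⟨z.1, hU⟩
      obtain ⟨d, hd, hdU⟩ := Sp.exists_basicOpen_subset U.2 hU
      refine ⟨c, b * d, by rw [Sp.eval_mul]; exact mul_ne_zero hb hd, fun w hw => ?_⟩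
      rw [Sp.eval_mul] at hw
      have hwU : w.1 ∈ U := hdU (right_ne_zero_of_mul hw)
      refine Eq.trans ?_ (h ⟨w.1, hwU⟩ (left_ne_zero_of_mul hw))
      exact (germ_spObj_iff (U := ⊤) (p := w.1) trivial hwU (Sp.ofSection ⊤ (a w)) t).1
        ((ha w).trans (ht w hwU).symm)
  refine ⟨Sp.ofSection ⊤ c, fun z => ?_⟩
  exact (germ_ofSection_iff.2 (hc z).symm).trans (ha z)

theorem isCInftySpace_spObj (hA : IsFinitelyGenerated A) : IsCInftySpace (SpObj A) where
  t2 := by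
    obtain ⟨n, π, hπ⟩ := hA
    exact (Sp.isClosedEmbedding_coords hπ).isEmbedding.t2Space
  isSheaf := isSheaf_spObj A
  soft := isSoft_spObj hA
  finitelyGenerated U := by
    obtain ⟨n, π, hπ⟩ := hA
    exact Sp.isFinitelyGenerated_sections hπ U
  isLocal p := isLocal_spObj p

end Spectrum

end CInftySpace

/-! ### Ring homomorphisms to `ℝ`. -/

namespace CInftyRing

attribute [local instance 50] toCommRing

/-- Constants, as a homomorphism of rings. -/
def SmoothFn.constHom (n : ℕ) : ℝ →+* SmoothFn n where
  toFun := SmoothFn.const n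
  map_one' := rfl
  map_zero' := rfl
  map_add' _ _ := rfl
  map_mul' _ _ := rfl

/-- Every ring homomorphism `C^∞(ℝⁿ) → ℝ` is the evaluation at a point. -/
theorem exists_eq_evalAt {n : ℕ} (h : SmoothFn n →+* ℝ) : ∃ y, ∀ f, h f = f y := by
  -- The identity is the only ring endomorphism of `ℝ`.
  have hc (c : ℝ) : h (SmoothFn.constHom n c) = c :=
    RingHom.congr_fun (Subsingleton.elim (h.comp (SmoothFn.constHom n)) (RingHom.id ℝ)) c
  refine ⟨fun i => h (SmoothFn.proj i), fun f => ?_⟩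
  -- As `h g = 0`, the function `g` is not a unit and so has a zero. A zero of this sum of squares
  -- has coordinates `h(x_i)`, and `f` takes the value `h f` there.
  let g : SmoothFn n := (f - SmoothFn.constHom n (h f)) * (f - SmoothFn.constHom n (h f)) +
    ∑ i, (SmoothFn.proj i - SmoothFn.constHom n (h (SmoothFn.proj i))) *
      (SmoothFn.proj i - SmoothFn.constHom n (h (SmoothFn.proj i)))
  have hg : h g = 0 := by
    simp only [g, map_add, map_mul, map_sub, map_sum, hc, sub_self, mul_zero,
      Finset.sum_const_zero, add_zero]
  obtain ⟨x, hx⟩ : ∃ x, g x = 0 := by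
    by_contra! hne
    let k : SmoothFn n := SmoothFn.mk (fun x => (g x)⁻¹) (g.contDiff.inv hne)
    have : g * k = 1 := SmoothFn.ext fun x => mul_inv_cancel₀ (hne x)
    have h1 := congrArg h this
    rw [map_mul, hg, zero_mul, map_one] at h1
    exact zero_ne_one h1
  have hgx : (f x - h f) * (f x - h f) +
      ∑ i, (x i - h (SmoothFn.proj i)) * (x i - h (SmoothFn.proj i)) = 0 := by
    rw [← hx]
    simp only [g, SmoothFn.add_apply, SmoothFn.mul_apply, SmoothFn.sub_apply, SmoothFn.sum_apply]
    rfl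
  have hs : 0 ≤ ∑ i, (x i - h (SmoothFn.proj i)) * (x i - h (SmoothFn.proj i)) :=
    Finset.sum_nonneg fun i _ => mul_self_nonneg _
  have h0 := mul_self_nonneg (f x - h f)
  have hxy : x = fun i => h (SmoothFn.proj i) := by
    funext i
    have h2 := (Finset.sum_eq_zero_iff_of_nonneg fun i _ => mul_self_nonneg _).1
      (le_antisymm (by linarith) hs) i (Finset.mem_univ i)
    exact sub_eq_zero.1 (mul_self_eq_zero.1 h2)
  rw [← hxy]
  exact (sub_eq_zero.1 (mul_self_eq_zero.1 (le_antisymm (by linarith) h0))).symm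

/-- A ring homomorphism from a finitely generated `C^∞`-ring to `ℝ` is a morphism of
`C^∞`-rings. -/
theorem map_op_of_isFinitelyGenerated {A : Type u} [CInftyRing A] (hA : IsFinitelyGenerated A)
    (χ : A →+* ℝ) {m : ℕ} (f : SmoothFn m) (a : Fin m → A) :
    χ (op f a) = f fun i => χ (a i) := by
  obtain ⟨n, π, hπ⟩ := hA
  obtain ⟨y, hy⟩ := exists_eq_evalAt (χ.comp π.ringHom)
  choose g hg using fun i => hπ (a i)
  obtain rfl : (fun i => π (g i)) = a := funext hg
  rw [← π.map_op]
  exact (hy _).trans (congrArg f.1 (funext fun i => (hy (g i)).symm))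

end CInftyRing

/-! ### A `C^∞`-space and the spectrum of its global sections. -/

namespace CInftySpace

open AlgebraicGeometry CInftyRing

attribute [local instance 50] toCommRing

theorem exists_value {R : Type u} [CommRing R] (h : IsLocalWithResidueFieldReal R) :
    ∃ v : R →+* ℝ, ∀ r, v r ≠ 0 ↔ IsUnit r := by
  obtain ⟨_, ⟨e⟩⟩ := h
  refine ⟨e.toRingHom.comp (IsLocalRing.residue R), fun r => ?_⟩
  rw [← IsLocalRing.residue_ne_zero_iff_isUnit]
  exact e.map_ne_zero_iff

namespace IsCInftySpace

variable {X : PresheafedSpace.{u} CInftyRingCat.{u}} (hX : IsCInftySpace X)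

/-- The value at a point of a germ. -/
def value (x : X.carrier) : Stalk X x →+* ℝ := (exists_value (hX.isLocal x)).choose

theorem value_ne_zero_iff (x : X.carrier) (r : Stalk X x) : hX.value x r ≠ 0 ↔ IsUnit r :=
  (exists_value (hX.isLocal x)).choose_spec r

/-- The point of the spectrum of the ring of global sections given by a point of the space. -/
def point (x : X.carrier) : Sp (Sec X ⊤) :=
  ⟨fun a => hX.value x (germ X ⊤ x trivial a), fun f a =>
    map_op_of_isFinitelyGenerated (hX.finitelyGenerated ⊤)
      ((hX.value x).comp (germ X ⊤ x trivial)) f a⟩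

theorem eval_point (x : X.carrier) (a : Sec X ⊤) :
    (hX.point x).eval a = hX.value x (germ X ⊤ x trivial a) := rfl

theorem eval_point_ne_zero_iff (x : X.carrier) (a : Sec X ⊤) :
    (hX.point x).eval a ≠ 0 ↔ IsUnit (germ X ⊤ x trivial a) := hX.value_ne_zero_iff x _

include hX in
-- Softness in the role of bump functions: the family `1` at `x`, `0` on `Z` is a section over the
-- closed set `Z ∪ {x}`.
theorem exists_separating {Z : Set X.carrier} (hZ : IsClosed Z) {x : X.carrier} (hx : x ∉ Z) :
    ∃ b : Sec X ⊤, germ X ⊤ x trivial b = 1 ∧ ∀ z ∈ Z, germ X ⊤ z trivial b = 0 := by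
  classical
  have := hX.t2
  have hx' : IsClosed {x} := isClosed_singleton
  obtain ⟨b, hb⟩ := hX.soft (Z ∪ {x}) (hZ.union hx') (fun z => if z.1 = x then 1 else 0) (by
    rintro ⟨z, hz⟩
    by_cases hzx : z = x
    · refine ⟨⟨Zᶜ, hZ.isOpen_compl⟩, hzx ▸ hx, 1, ?_⟩
      rintro ⟨w, hw⟩ hwZ
      have hwx : w = x := hw.resolve_left hwZ
      exact (map_one (germ X ⟨Zᶜ, hZ.isOpen_compl⟩ w hwZ)).trans (if_pos hwx).symm
    · refine ⟨⟨{x}ᶜ, hx'.isOpen_compl⟩, hzx, 0, ?_⟩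
      rintro ⟨w, hw⟩ hwx
      have hwx' : w ≠ x := hwx
      exact (map_zero (germ X ⟨{x}ᶜ, hx'.isOpen_compl⟩ w hwx)).trans (if_neg hwx').symm)
  refine ⟨b, (hb ⟨x, Or.inr rfl⟩).trans (if_pos rfl), fun z hz => ?_⟩
  exact (hb ⟨z, Or.inl hz⟩).trans (if_neg fun h : z = x => hx (h ▸ hz))

include hX in
theorem exists_germ_top_eq {x : X.carrier} (r : Stalk X x) :
    ∃ a : Sec X ⊤, germ X ⊤ x trivial a = r := by
  have := hX.t2
  obtain ⟨U, hU, t, rfl⟩ := exists_germ_eq r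
  have hmem (z : ({x} : Set X.carrier)) : z.1 ∈ U := by
    rw [Set.mem_singleton_iff.1 z.2]
    exact hU
  obtain ⟨a, ha⟩ := hX.soft {x} isClosed_singleton (fun z => germ X U z.1 (hmem z) t)
    fun z => ⟨U, hmem z, t, fun _ _ => rfl⟩
  exact ⟨a, ha ⟨x, rfl⟩⟩

include hX in
theorem isUnit_of_isUnit_germ (a : Sec X ⊤) (h : ∀ x, IsUnit (germ X ⊤ x trivial a)) :
    IsUnit a := by
  let Y : RingedSpace := ⟨⟨X.carrier, ringPresheaf X⟩, hX.isSheaf⟩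
  exact Y.isUnit_of_isUnit_germ ⊤ a fun x _ => h x

/-- An element nonzero at `x` has an invertible germ, so it can be cancelled in the stalk.
Conversely, if the germs agree on `W`, a separating section that vanishes off `W` equalizes `c` and
`c'` globally. -/
theorem of_point_eq_iff (x : X.carrier) {c c' : Sec X ⊤} :
    Loc.of _ (Sp.nonvanishingAt (hX.point x)) c = Loc.of _ (Sp.nonvanishingAt (hX.point x)) c' ↔
      germ X ⊤ x trivial c = germ X ⊤ x trivial c' := by
  rw [Sp.of_eq_of_iff]
  constructor
  · rintro ⟨b, hb, h⟩
    have h1 := congrArg (germ X ⊤ x trivial) h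
    rw [map_mul, map_mul] at h1
    exact ((hX.eval_point_ne_zero_iff x b).1 hb).mul_left_cancel h1
  · intro h
    obtain ⟨W, hW, hWe⟩ := eventually_germ_eq h
    obtain ⟨b, hb, hb0⟩ := hX.exists_separating W.2.isClosed_compl (x := x) (fun h => h hW)
    refine ⟨b, (hX.eval_point_ne_zero_iff x b).2 (hb ▸ isUnit_one), ?_⟩
    refine sec_ext hX.isSheaf fun y hy => ?_
    rw [map_mul, map_mul]
    by_cases hyW : y ∈ W
    · rw [hWe y hyW trivial trivial]
    · rw [hb0 y hyW, zero_mul, zero_mul]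

/-- If `p` came from no point of `X`, then `∑ (x_i - y_i)²`, with `y` the coordinates of `p`, would
have invertible germs everywhere and so be a unit; but `p` kills it. -/
theorem point_surjective : Function.Surjective hX.point := by
  intro p
  obtain ⟨n, π, hπ⟩ := hX.finitelyGenerated ⊤
  let y := Sp.coords π p
  let g : SmoothFn n := ∑ i, (SmoothFn.proj i - SmoothFn.constHom n (y i)) *
    (SmoothFn.proj i - SmoothFn.constHom n (y i))
  have hg (z : Fin n → ℝ) : g z = ∑ i, (z i - y i) * (z i - y i) := by
    simp only [g, SmoothFn.mul_apply, SmoothFn.sub_apply, SmoothFn.sum_apply]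
    rfl
  by_contra! hne
  have hu : IsUnit (π g) := hX.isUnit_of_isUnit_germ _ fun x => by
    rw [← hX.eval_point_ne_zero_iff, Sp.eval_apply, hg]
    intro h0
    refine hne x (Sp.coords_injective hπ (funext fun i => ?_))
    have h2 := (Finset.sum_eq_zero_iff_of_nonneg fun i _ => mul_self_nonneg _).1 h0 i
      (Finset.mem_univ i)
    exact sub_eq_zero.1 (mul_self_eq_zero.1 h2)
  refine (hu.map p.evalRingHom).ne_zero ?_
  refine (Sp.eval_apply π p g).trans ((hg _).trans ?_)
  exact Finset.sum_eq_zero fun i _ => by rw [sub_self, zero_mul]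

/-- Characterizes `point x` by vanishing germs alone, without the residue field: any other point is
detected by a separating section. -/
theorem eq_of_germ_eq {x : X.carrier} {p : Sp (Sec X ⊤)}
    (h : ∀ a : Sec X ⊤, germ X ⊤ x trivial a = 0 → p.eval a = 0) : hX.point x = p := by
  have := hX.t2
  obtain ⟨y, rfl⟩ := hX.point_surjective p
  by_contra hne
  have hxy : y ∉ ({x} : Set X.carrier) := fun hyx => hne (by rw [Set.mem_singleton_iff.1 hyx])
  obtain ⟨b, hb, hb0⟩ := hX.exists_separating isClosed_singleton hxy
  exact (hX.eval_point_ne_zero_iff y b).2 (hb ▸ isUnit_one) (h b (hb0 x rfl))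

theorem point_injective : Function.Injective hX.point := by
  have := hX.t2
  intro x y h
  by_contra hne
  have hxy : x ∉ ({y} : Set X.carrier) := hne
  obtain ⟨b, hb, hb0⟩ := hX.exists_separating isClosed_singleton hxy
  refine (hX.eval_point_ne_zero_iff x b).2 (hb ▸ isUnit_one) ?_
  rw [h, eval_point, hb0 y rfl, map_zero]

theorem continuous_point : Continuous hX.point := by
  refine continuous_generateFrom_iff.2 ?_
  rintro _ ⟨a, rfl⟩
  let Y : RingedSpace := ⟨⟨X.carrier, ringPresheaf X⟩, hX.isSheaf⟩
  have : hX.point ⁻¹' Sp.basicOpen a = (Y.basicOpen (U := ⊤) a : Set X.carrier) := by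
    ext x
    exact (hX.eval_point_ne_zero_iff x a).trans (Y.mem_top_basicOpen a x).symm
  rw [this]
  exact (Y.basicOpen (U := ⊤) a).2

/-- A section separating `x` from `Z` gives a basic neighbourhood of `point x` that misses the image
of `Z`. -/
theorem isClosedMap_point : IsClosedMap hX.point := by
  intro Z hZ
  rw [← isOpen_compl_iff, isOpen_iff_mem_nhds]
  intro p hp
  obtain ⟨x, rfl⟩ := hX.point_surjective p
  obtain ⟨b, hb, hb0⟩ := hX.exists_separating hZ (x := x) fun hx => hp ⟨x, hx, rfl⟩
  refine Filter.mem_of_superset ((Sp.isOpen_basicOpen b).mem_nhds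
    ((hX.eval_point_ne_zero_iff x b).2 (hb ▸ isUnit_one))) ?_
  rintro _ hq ⟨z, hz, rfl⟩
  refine hq ?_
  rw [eval_point, hb0 z hz, map_zero]

/-- The space is homeomorphic to the spectrum of the ring of global sections. -/
def homeomorph : X.carrier ≃ₜ Sp (Sec X ⊤) :=
  (Equiv.ofBijective hX.point ⟨hX.point_injective, hX.point_surjective⟩).toHomeomorphOfContinuousClosed
    hX.continuous_point hX.isClosedMap_point

include hX in
/-- The ring of global sections is germ determined. -/
theorem isGermDetermined_ker {n : ℕ} (π : Hom (SmoothFn n) (Sec X ⊤)) :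
    IsGermDeterminedIdeal π.ker := by
  intro f hf
  by_contra! h
  refine hf ((π.mem_ker f).2 (sec_ext hX.isSheaf fun x _ => ?_))
  -- If `f` has everywhere the germ of a kernel element, then `π f` has zero germ at every point of
  -- `X`, hence is zero.
  obtain ⟨g, hg, hfg⟩ := h (Sp.coords π (hX.point x))
  have h1 := (hX.of_point_eq_iff x).1 (Sp.of_eq_of_eventuallyEq π (hX.point x) hfg)
  rwa [(π.mem_ker g).1 hg] at h1

include hX in
theorem isGeometric : CInftyRingCat.isGeometric (PresheafedSpace.Γ.obj (op X)) := by
  refine ⟨hX.finitelyGenerated ⊤, ?_⟩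
  obtain ⟨n, π, hπ⟩ := hX.finitelyGenerated ⊤
  exact ⟨n, π, hπ, hX.isGermDetermined_ker π⟩

end IsCInftySpace

theorem isIso_of_bijective {A B : CInftyRingCat.{u}} (φ : A ⟶ B)
    (h : Function.Bijective (Hom.toFun φ)) : IsIso φ :=
  ⟨Hom.inverse φ h, CInftyRing.Hom.ext (funext fun s => Hom.inverse_apply φ h s),
    CInftyRing.Hom.ext (funext fun s => Hom.apply_inverse φ h s)⟩

/-! ### The comparison of a `C^∞`-space with its spectrum. -/

namespace IsCInftySpace

variable {X : PresheafedSpace.{u} CInftyRingCat.{u}} (hX : IsCInftySpace X)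

/-- The open subset of the space given by an open subset of the spectrum. -/
def preimage (V : Opens (Sp (Sec X ⊤))) : Opens X.carrier :=
  ⟨hX.point ⁻¹' V, V.2.preimage hX.continuous_point⟩

/-- A section of the structure sheaf of the spectrum and a section of the sheaf of the space that
have the same germs. -/
def SameGerms {V : Opens (Sp (Sec X ⊤))} (s : Sp.Sections V) (t : Sec X (hX.preimage V)) : Prop :=
  ∀ (x : X.carrier) (hx : x ∈ hX.preimage V) (c : Sec X ⊤),
    s.1 ⟨hX.point x, hx⟩ = Loc.of _ (Sp.nonvanishingAt (hX.point x)) c →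
      germ X (hX.preimage V) x hx t = germ X ⊤ x trivial c

/-- Each value of `s` is the class of a global section, whose germ is well defined by
`of_point_eq_iff`. Locally one global section serves, so the germs glue. -/
theorem exists_sameGerms {V : Opens (Sp (Sec X ⊤))} (s : Sp.Sections V) :
    ∃ t, hX.SameGerms s t := by
  choose c hc using fun x : hX.preimage V =>
    Sp.of_surjective (hX.point x.1) (s.1 ⟨hX.point x.1, x.2⟩)
  obtain ⟨t, ht⟩ := exists_sec hX.isSheaf (hX.preimage V)
    (fun x => germ X ⊤ x.1 trivial (c x)) fun x => by
      obtain ⟨d, b, hb, h⟩ := Sp.exists_of_section s ⟨hX.point x.1, x.2⟩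
      refine ⟨⟨hX.point ⁻¹' Sp.basicOpen b,
        (Sp.isOpen_basicOpen b).preimage hX.continuous_point⟩, ⊤, d, hb, le_top,
        fun y hy _ => (hX.of_point_eq_iff y.1).1 ?_⟩
      exact (hc y).trans (h ⟨hX.point y.1, y.2⟩ hy)
  refine ⟨t, fun x hx d hd => (ht ⟨x, hx⟩).trans ?_⟩
  exact (hX.of_point_eq_iff x).1 ((hc ⟨x, hx⟩).trans hd)

variable {hX} in
theorem SameGerms.unique {V : Opens (Sp (Sec X ⊤))} {s : Sp.Sections V}
    {t t' : Sec X (hX.preimage V)} (h : hX.SameGerms s t) (h' : hX.SameGerms s t') : t = t' := by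
  refine sec_ext hX.isSheaf fun x hx => ?_
  obtain ⟨c, hc⟩ := Sp.of_surjective (hX.point x) (s.1 ⟨hX.point x, hx⟩)
  rw [h x hx c hc.symm, h' x hx c hc.symm]

/-- The comparison morphism from the structure sheaf of the spectrum of the ring of global sections
to the sheaf of the space. -/
def compare (V : Opens (Sp (Sec X ⊤))) : Hom (Sp.Sections V) (Sec X (hX.preimage V)) where
  toFun s := (hX.exists_sameGerms s).choose
  map_op {n} f s := by
    refine SameGerms.unique (hX.exists_sameGerms _).choose_spec fun x hx c hc => ?_
    choose d hd using fun i => Sp.of_surjective (hX.point x) ((s i).1 ⟨hX.point x, hx⟩)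
    refine (germ_op_congr f (V := ⊤) (hV := trivial) (t := d) fun i =>
      (hX.exists_sameGerms (s i)).choose_spec x hx (d i) (hd i).symm).trans ?_
    refine (hX.of_point_eq_iff x).1 (Eq.trans ?_ hc)
    refine ((Loc.of _ (Sp.nonvanishingAt (hX.point x))).map_op f d).trans ?_
    exact congrArg (CInftyRing.op f) (funext hd)

theorem sameGerms_compare {V : Opens (Sp (Sec X ⊤))} (s : Sp.Sections V) :
    hX.SameGerms s (hX.compare V s) := (hX.exists_sameGerms s).choose_spec

theorem compare_injective (V : Opens (Sp (Sec X ⊤))) : Function.Injective (hX.compare V) := by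
  intro s s' h
  refine Subtype.ext (funext fun p => ?_)
  obtain ⟨p, hp⟩ := p
  obtain ⟨x, rfl⟩ := hX.point_surjective p
  obtain ⟨c, hc⟩ := Sp.of_surjective (hX.point x) (s.1 ⟨hX.point x, hp⟩)
  obtain ⟨c', hc'⟩ := Sp.of_surjective (hX.point x) (s'.1 ⟨hX.point x, hp⟩)
  rw [← hc, ← hc', hX.of_point_eq_iff, ← hX.sameGerms_compare s x hp c hc.symm,
    ← hX.sameGerms_compare s' x hp c' hc'.symm, h]

/-- By softness each germ of `t` is the germ of a global section. Their classes form a section over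
the spectrum because `point` is open: equality of germs on `W` carries over to the open image of
`W`. -/
theorem compare_surjective (V : Opens (Sp (Sec X ⊤))) : Function.Surjective (hX.compare V) := by
  intro t
  choose x hx using hX.point_surjective
  have hxV (p : V) : x p.1 ∈ hX.preimage V := by
    change hX.point (x p.1) ∈ V
    rw [hx]
    exact p.2
  choose c hc using fun p : V => hX.exists_germ_top_eq (germ X (hX.preimage V) (x p.1) (hxV p) t)
  let s : Sp.Sections V := ⟨fun p => Loc.of _ (Sp.nonvanishingAt p.1) (c p), by
    refine Sp.isLocallyFraction_of _ fun p => ?_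
    obtain ⟨W, hW, h⟩ := eventually_germ_eq (hc p)
    refine ⟨c p, hX.homeomorph '' W, hX.homeomorph.isOpenMap _ W.2, ⟨x p.1, hW, hx p.1⟩,
      fun q hq => ?_⟩
    obtain ⟨y, hy, hyq⟩ := hq
    have hyq : hX.point y = q.1 := hyq
    have hxy : x q.1 = y := hX.point_injective ((hx q.1).trans hyq.symm)
    have h1 := (hX.of_point_eq_iff (x q.1)).2
      ((hc q).trans (h (x q.1) (hxy ▸ hy) trivial (hxV q)).symm)
    rwa [hx] at h1⟩
  refine ⟨s, SameGerms.unique (hX.sameGerms_compare s) fun y hy d hd => ?_⟩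
  have hxy : x (hX.point y) = y := hX.point_injective (hx _)
  have h1 := (hX.of_point_eq_iff y).1 hd
  rw [← h1]
  have key (z : X.carrier) (hz : z = y) (hzV : z ∈ hX.preimage V) (a : Sec X ⊤)
      (ha : germ X ⊤ z trivial a = germ X (hX.preimage V) z hzV t) :
      germ X (hX.preimage V) y hy t = germ X ⊤ y trivial a := by
    subst hz
    exact ha.symm
  exact key _ hxy _ _ (hc ⟨hX.point y, hy⟩)

/-- The comparison morphism from a space to the spectrum of its ring of global sections. -/
def toSp : X ⟶ SpObj (X.presheaf.obj (op ⊤)) where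
  base := TopCat.ofHom ⟨hX.point, hX.continuous_point⟩
  c :=
    { app := fun V => hX.compare V.unop
      naturality := fun U V i => by
        refine CInftyRing.Hom.ext (funext fun s => ?_)
        refine SameGerms.unique (hX := hX) (hX.sameGerms_compare _) fun x hx c hc => ?_
        refine (germ_map _ x hx _).trans ?_
        exact hX.sameGerms_compare s x _ c hc }

theorem isIso_toSp : IsIso hX.toSp := by
  have h1 : IsIso hX.toSp.base := (TopCat.isoOfHomeo (X := X.carrier)
    (Y := TopCat.of (Sp (Sec X ⊤))) hX.homeomorph).isIso_hom
  have h2 (V) : IsIso (hX.toSp.c.app V) :=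
    isIso_of_bijective _ ⟨hX.compare_injective V.unop, hX.compare_surjective V.unop⟩
  have h3 : IsIso hX.toSp.c := NatIso.isIso_of_isIso_app _
  exact PresheafedSpace.isIso_of_components _

/-- Morphisms are not assumed local on stalks. They preserve zero germs, and this already determines
the image point. -/
theorem comap_point {Y : PresheafedSpace.{u} CInftyRingCat.{u}} (hY : IsCInftySpace Y) (f : X ⟶ Y)
    (x : X.carrier) : hY.point (f.base x) = Sp.comap (appHom f ⊤) (hX.point x) := by
  refine hY.eq_of_germ_eq fun a ha => ?_
  have h1 : germ X ⊤ x trivial (appHom f ⊤ a) = germ X ⊤ x trivial (appHom f ⊤ 0) :=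
    germ_appHom_congr f (U := ⊤) (V := ⊤) (x := x) (hU := trivial) (hV := trivial)
      (ha.trans (map_zero (germ Y ⊤ (f.base x) trivial)).symm)
  have h2 : hX.value x (germ X ⊤ x trivial (appHom f ⊤ a)) = 0 := by
    rw [h1]
    exact map_zero ((hX.value x).comp ((germ X ⊤ x trivial).comp (appHom f ⊤).ringHom))
  exact h2

/-- On sections, compare germs at `x`: if `c` represents `s` at the image point, both sides have the
germ of the pullback of `c`. -/
theorem toSp_naturality {Y : PresheafedSpace.{u} CInftyRingCat.{u}} (hY : IsCInftySpace Y)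
    (f : X ⟶ Y) :
    f ≫ hY.toSp = hX.toSp ≫ SpMap (f.c.app (op ⊤)) := by
  refine PresheafedSpace.ext _ _ (TopCat.ext fun x => hX.comap_point hY f x)
    (NatTrans.ext (funext fun V => CInftyRing.Hom.ext (funext fun s => ?_)))
  refine sec_ext hX.isSheaf fun x hx => ?_
  have hx2 : hY.point (f.base x) ∈ V.unop := (hX.comap_point hY f x).symm ▸ hx
  obtain ⟨c, hc⟩ := Sp.of_surjective (hY.point (f.base x))
    ((show Sp.Sections V.unop from s).1 ⟨hY.point (f.base x), hx2⟩)
  have h1 : germ X ⊤ x trivial (appHom f ⊤ c) = germ X _ x hx (Hom.toFun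
      ((hX.toSp ≫ SpMap (f.c.app (op ⊤))).c.app V) s) := by
    symm
    let W : Opens (Sp (Sec X ⊤)) := ⟨Sp.comap (appHom f ⊤) ⁻¹' (show Set (Sp (Sec Y ⊤)) from V.unop.1),
      V.unop.2.preimage (Sp.continuous_comap _)⟩
    refine hX.sameGerms_compare (Sp.sectionsMap (appHom f ⊤) V.unop W (fun _ h => h) s) x hx _ ?_
    have key (q : Sp (Sec Y ⊤)) (hq : q = hY.point (f.base x)) (hqV : q ∈ V.unop) :
        (show Sp.Sections V.unop from s).1 ⟨q, hqV⟩ = Loc.of _ (Sp.nonvanishingAt q) c := by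
      subst hq
      exact hc.symm
    exact congrArg (Sp.locAtMap (appHom f ⊤) (hX.point x)) (key _ (hX.comap_point hY f x).symm hx)
  rw [← h1]
  refine (germ_map _ x hx _).trans ?_
  exact germ_appHom_congr f (U := hY.preimage V.unop) (V := ⊤) (x := x) (hU := hx2) (hV := trivial)
    (hY.sameGerms_compare s (f.base x) hx2 c hc.symm)

end IsCInftySpace

/-! ### The equivalence of categories. -/

/-- The morphism from a `C^∞`-ring to the ring of global sections of its spectrum. -/
def toGamma (A : CInftyRingCat.{u}) : A ⟶ (SpObj A).presheaf.obj (op ⊤) := Sp.ofSection ⊤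

theorem isIso_toGamma {A : CInftyRingCat.{u}} (hA : IsGermDetermined A) : IsIso (toGamma A) := by
  obtain ⟨n, π, hπ, hd⟩ := hA
  exact isIso_of_bijective _ (Sp.ofSection_top_bijective hπ hd)

/-- A `C^∞`-ring in `𝒢` is isomorphic to the ring of global sections of its spectrum. -/
def unitIso
    (hΓ : ∀ X : isCInftySpace.{u}.FullSubcategory,
      CInftyRingCat.isGeometric (PresheafedSpace.Γ.obj (op X.obj)))
    (hSp : ∀ A : CInftyRingCat.isGeometric.{u}.FullSubcategory,
      isCInftySpace (spFunctor.obj (op A.obj))) :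
    spG hSp ⋙ gammaG hΓ ≅ 𝟭 CInftyRingCat.isGeometric.{u}.FullSubcategoryᵒᵖ :=
  NatIso.ofComponents
    (fun A => (CInftyRingCat.isGeometric.isoMk (X := A.unop)
      (Y := ((spG hSp ⋙ gammaG hΓ).obj A).unop)
      (@asIso _ _ _ _ (toGamma A.unop.obj) (isIso_toGamma A.unop.property.2))).op)
    -- Naturality is definitional: both composites send `a` to the section given by its image.
    fun _ => Quiver.Hom.unop_inj (ObjectProperty.hom_ext _ rfl)

/-- A `C^∞`-space is isomorphic to the spectrum of its ring of global sections. -/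
def counitIso
    (hΓ : ∀ X : isCInftySpace.{u}.FullSubcategory,
      CInftyRingCat.isGeometric (PresheafedSpace.Γ.obj (op X.obj)))
    (hSp : ∀ A : CInftyRingCat.isGeometric.{u}.FullSubcategory,
      isCInftySpace (spFunctor.obj (op A.obj))) :
    𝟭 isCInftySpace.{u}.FullSubcategory ≅ gammaG hΓ ⋙ spG hSp :=
  NatIso.ofComponents
    (fun X => isCInftySpace.isoMk (X := X) (Y := (gammaG hΓ ⋙ spG hSp).obj X)
      (@asIso _ _ _ _ (IsCInftySpace.toSp X.property) (IsCInftySpace.isIso_toSp X.property)))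
    fun {X Y} f => ObjectProperty.hom_ext _ (IsCInftySpace.toSp_naturality X.property Y.property f.hom)

end CInftySpace

end

theorem mainTheorem6 :
    ∃ (hΓ : ∀ X : CInftySpace.isCInftySpace.{u}.FullSubcategory,
          CInftyRingCat.isGeometric (AlgebraicGeometry.PresheafedSpace.Γ.obj (op X.obj)))
      (hSp : ∀ A : CInftyRingCat.isGeometric.{u}.FullSubcategory,
          CInftySpace.isCInftySpace (CInftySpace.spFunctor.obj (op A.obj)))
      (e : CInftyRingCat.isGeometric.{u}.FullSubcategoryᵒᵖ ≌
          CInftySpace.isCInftySpace.{u}.FullSubcategory),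
      e.functor = CInftySpace.spG hSp ∧ e.inverse = CInftySpace.gammaG hΓ := by
  have hΓ (X : CInftySpace.isCInftySpace.{u}.FullSubcategory) :
      CInftyRingCat.isGeometric (AlgebraicGeometry.PresheafedSpace.Γ.obj (op X.obj)) :=
    CInftySpace.IsCInftySpace.isGeometric X.property
  have hSp (A : CInftyRingCat.isGeometric.{u}.FullSubcategory) :
      CInftySpace.isCInftySpace (CInftySpace.spFunctor.obj (op A.obj)) :=
    CInftySpace.isCInftySpace_spObj A.property.1
  -- `Equivalence.mk` corrects the unit to obtain the triangle identity and leaves the two functors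
  -- untouched, so both equations hold by `rfl`.
  exact ⟨hΓ, hSp, CategoryTheory.Equivalence.mk (CInftySpace.spG hSp) (CInftySpace.gammaG hΓ)
    (CInftySpace.unitIso hΓ hSp).symm (CInftySpace.counitIso hΓ hSp).symm, rfl, rfl⟩
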